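/- Let $M$ be a compact Hausdorff $C^\infty$ Riemannian manifold of finite dimension, with or without boundary. Let $X$ be a vector field on $M$, pointing strictly inward at every point of $\partial M$, that generates a $C^1$ flow $X_t$ (for instance any $C^1$ vector field with this boundary condition). Here $X_t\colon M\to M$ is defined for $t\ge 0$; for $t<0$ the map $X_t$ is the inverse of $X_{-t}$, defined on $X_{-t}(M)$, which is all of $M$ if $\partial M=\emptyset$. The map $(t,x)\mapsto X_t(x)$ is $C^1$ where it is defined. Let $\Lambda\subset M$ be a compact set with $X_t(\Lambda)=\Lambda$ for all $t\in\mathbb R$, and let $T_\Lambda M=E\oplus F$ be a continuous splitting which is invariant, i.e. $DX_t(E_x)=E_{X_t(x)}$ and $DX_t(F_x)=F_{X_t(x)}$ for all $x\in\Lambda$, $t\in\mathbb R$, with $E_x\ne\{0\}$ and $F_x\neq\{0\}$ for every $x\in\Lambda$. No assumption is made on the singularities of $X$ in $\Lambda$. The splitting is called dominated if there are constants $K,\lambda>0$ such that $$\|DX_t|_{E_x}\|\cdot\|DX_{-t}|_{F_{X_t(x)}}\|<K e^{-\lambda t}\qquad\text{for all }x\in\Lambda,\ t>0.$$ A Borel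 set $Y\subset\Lambda$ has total probability in $\Lambda$ if $\mu(Y)=1$ for every Borel probability measure $\mu$ carried by $\Lambda$ that is invariant under $X_t$ for all $t\in\mathbb R$. For a linear map $A$ between finite-dimensional inner product spaces with nonzero domain, $m(A)=\inf_{\|v\|=1}\|Av\|$ denotes its co-norm. Then $T_\Lambda M=E\oplus F$ is a dominated splitting if and only if there exist $\eta<0$ and a set $Y\subset\Lambda$ of total probability in $\Lambda$ such that, for every $x\in Y$, $$\liminf_{t\to+\infty}\frac1t\log\|DX_t|_{E_x}\|-\limsup_{t\to+\infty}\frac1t\log m(DX_t|_{F_x})<\eta.$$ -/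

import Mathlib

open Set Filter Topology MeasureTheory Manifold Bundle
open scoped ContDiff

noncomputable section

namespace LyapunovDomination

variable {n : ℕ} {H : Type*} [TopologicalSpace H]
  {I : ModelWithCorners ℝ (EuclideanSpace ℝ (Fin n)) H}
  {M : Type*} [TopologicalSpace M] [ChartedSpace H M] [IsManifold I ∞ M]

/-! ### Flows on a compact manifold with or without boundary -/

/-- The set of pairs `(t, x)` for which `X_t(x)` is defined. It contains all `t ≥ 0`; for `t < 0`,
the map `X_t` is the inverse of `X_{-t}`, defined on the image `X_{-t}(M)`. If `M` has no boundary
this image is all of `M`. -/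
def flowDomain (φ : ℝ → M → M) : Set (ℝ × M) :=
  {p | 0 ≤ p.1 ∨ p.2 ∈ range (φ (-p.1))}

/-- `φ t = X_t` is the `C^1` flow generated by the vector field `X`. The values of `φ` outside
`flowDomain φ` are irrelevant. -/
structure IsC1Flow (X : ∀ x : M, TangentSpace I x) (φ : ℝ → M → M) : Prop where
  map_zero : ∀ x, φ 0 x = x
  map_add : ∀ s t : ℝ, 0 ≤ s → 0 ≤ t → ∀ x, φ (s + t) x = φ s (φ t x)
  left_inv : ∀ t : ℝ, 0 ≤ t → ∀ x, φ (-t) (φ t x) = x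
  contMDiffOn : ContMDiffOn (𝓘(ℝ, ℝ).prod I) I 1 (fun p : ℝ × M => φ p.1 p.2) (flowDomain φ)
  generator : ∀ x, IsMIntegralCurveOn (fun t => φ t x) X (Ici 0)

/-- The coordinate vector of a tangent vector at `x` in the preferred chart at `x` (by definition of
`TangentSpace` this is the vector itself). -/
def coordVector {x : M} (v : TangentSpace I x) : EuclideanSpace ℝ (Fin n) := v

/-- The vector field `X` points strictly into `M` at every boundary point (no condition if the
boundary is empty). For the half-space `{y | 0 ≤ y 0}` the condition says that the coordinate `0`
of `X x` is positive. -/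
def IsInwardAtBoundary (X : ∀ x : M, TangentSpace I x) : Prop :=
  ∀ x ∈ I.boundary M, ∀ᶠ s : ℝ in 𝓝[>] 0,
    extChartAt I x x + s • coordVector (X x) ∈ interior (range I)

/-- `X_t(Λ) = Λ` for all real `t`. -/
def IsInvariantSet (φ : ℝ → M → M) (Λ : Set M) : Prop :=
  ∀ t : ℝ, φ t '' Λ = Λ

/-! ### Splittings of the tangent bundle over `Λ` -/

/-- `E` is a continuous subbundle of `T_Λ M`: near each point of `Λ` it has a continuous frame.
The rank is locally constant on `Λ`. Values of `E` outside `Λ` are irrelevant. -/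
def IsContinuousSubbundle (Λ : Set M) (E : ∀ x : M, Submodule ℝ (TangentSpace I x)) : Prop :=
  ∀ x₀ ∈ Λ, ∃ U : Set M, IsOpen U ∧ x₀ ∈ U ∧
    ∃ (k : ℕ) (s : Fin k → ∀ x : M, TangentSpace I x),
      (∀ i, ContinuousOn (fun x => (⟨x, s i x⟩ : TangentBundle I M)) (U ∩ Λ)) ∧
      ∀ x ∈ U ∩ Λ, LinearIndependent ℝ (fun i => s i x) ∧
        Submodule.span ℝ (range fun i => s i x) = E x

/-- `E` is `DX_t`-invariant over `Λ`. -/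
def IsInvariantSubbundle (φ : ℝ → M → M) (Λ : Set M)
    (E : ∀ x : M, Submodule ℝ (TangentSpace I x)) : Prop :=
  ∀ x ∈ Λ, ∀ t : ℝ, (E x).map (mfderiv I I (φ t) x).toLinearMap = E (φ t x)

/-- `T_Λ M = E ⊕ F` is a continuous `DX_t`-invariant splitting with nonzero fibres. -/
structure IsContinuousInvariantSplitting (φ : ℝ → M → M) (Λ : Set M)
    (E F : ∀ x : M, Submodule ℝ (TangentSpace I x)) : Prop where
  isCompl : ∀ x ∈ Λ, IsCompl (E x) (F x)
  ne_bot_left : ∀ x ∈ Λ, E x ≠ ⊥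
  ne_bot_right : ∀ x ∈ Λ, F x ≠ ⊥
  continuous_left : IsContinuousSubbundle Λ E
  continuous_right : IsContinuousSubbundle Λ F
  invariant_left : IsInvariantSubbundle φ Λ E
  invariant_right : IsInvariantSubbundle φ Λ F

section Metric

variable [RiemannianBundle (fun x : M => TangentSpace I x)]

/-- The operator norm `‖DX_t|_V‖` of the derivative of `X_t` at `x` restricted to `V ⊆ T_x M`. -/
def normRestrict (φ : ℝ → M → M) (t : ℝ) (x : M) (V : Submodule ℝ (TangentSpace I x)) : ℝ :=
  ‖(mfderiv I I (φ t) x).comp V.subtypeL‖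

/-- The co-norm `m(DX_t|_V)`: the infimum of `‖DX_t v‖` over unit vectors `v ∈ V`. -/
def conormRestrict (φ : ℝ → M → M) (t : ℝ) (x : M) (V : Submodule ℝ (TangentSpace I x)) : ℝ :=
  ⨅ v : {v : V // ‖v‖ = 1}, ‖mfderiv I I (φ t) x (v : V)‖

/-- `T_Λ M = E ⊕ F` is a dominated splitting. -/
structure IsDominatedSplitting (φ : ℝ → M → M) (Λ : Set M)
    (E F : ∀ x : M, Submodule ℝ (TangentSpace I x)) : Prop
    extends IsContinuousInvariantSplitting φ Λ E F where
  dominated : ∃ K > 0, ∃ r > 0, ∀ x ∈ Λ, ∀ t : ℝ, 0 < t →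
    normRestrict φ t x (E x) * normRestrict φ (-t) (φ t x) (F (φ t x)) < K * Real.exp (-r * t)

end Metric

/-! ### Total probability -/

variable [MeasurableSpace M]

/-- `μ` is a probability measure carried by `Λ` and invariant under `X_t` for every real `t`. -/
structure IsInvariantProbability (φ : ℝ → M → M) (Λ : Set M) (μ : Measure M) : Prop where
  isProbabilityMeasure : IsProbabilityMeasure μ
  carried : μ Λᶜ = 0
  invariant : ∀ t : ℝ, ∀ A : Set M, MeasurableSet A → μ (φ t ⁻¹' A) = μ A

/-- `Y` is a total probability subset of `Λ`. -/
def HasTotalProbability (φ : ℝ → M → M) (Λ Y : Set M) : Prop :=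
  Y ⊆ Λ ∧ MeasurableSet Y ∧ ∀ μ : Measure M, IsInvariantProbability φ Λ μ → μ Y = 1

end LyapunovDomination

end

namespace LyapunovDomination

/-! ### A half of the subadditive ergodic theorem -/

section Subadditive

variable {Ω : Type*}

/-! The functions `f t x = log ‖DX_t|E_x‖` and `g t x = -log m(DX_t|F_x)` are continuous subadditive
cocycles over the semiflow on the compact set `Λ`. Since `‖DX_{-t}|F_{X_t x}‖ = 1 / m(DX_t|F_x)`
(`IsC1Flow.normRestrict_neg`), domination says exactly that `f + g` decreases linearly in `t`,
uniformly on `Λ`. Since `limsup u = -liminf (-u)`, the Lyapunov condition says that the lower growth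
rates of `f` and `g` add up to less than `η`. Domination therefore gives the condition on all of
`Λ`, by dividing by `t`.

For the converse, a subadditive cocycle on a compact space decreases linearly as soon as every orbit
has an integer time at which it is negative (`exists_linear_decay`). If some orbit has no such time
for `f + g`, a Krylov-Bogoliubov limit of its time averages is an invariant probability `μ` with `∫
(f_m + g_m) dμ ≥ 0` for all `m ≥ 1` (`exists_invariant_measure`). On the other hand, half of the
subadditive ergodic theorem (`eventually_integral_le_integral_liminf`) bounds `∫ f_n dμ / n`
asymptotically by the integral of the lower growth rate of `f`, and likewise for `g`. A set of total
probability has full `μ`-measure, so these two integrals sum to at most `η < 0`, a contradiction.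

The half ergodic theorem is proved by a greedy covering of orbits. Its growth rates are exactly
invariant, not just almost everywhere, because invertibility of the derivative on the fibres gives
the reverse inequality `le_shift`. -/

theorem subadditive_le_sum_of_hitting {T : Ω → Ω} {f : ℕ → Ω → ℝ} {α : Ω → ℝ} {D : ℝ}
    (hD : ∀ n x, |f n x| ≤ D * (n + 1))
    (hsub : ∀ m n x, f (m + n) x ≤ f m (T^[n] x) + f n x)
    (hα : ∀ x, |α x| ≤ 2 * D) (hαT : ∀ x, α (T x) = α x) (k : ℕ) (E : Set Ω)
    (hE : ∀ x ∈ E, ∃ j, 1 ≤ j ∧ j ≤ k ∧ f j x ≤ j * α x) [DecidablePred (· ∈ E)] (n : ℕ) (x : Ω) :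
    f n x ≤ ∑ i ∈ Finset.range n, (if T^[i] x ∈ E then α (T^[i] x) else 2 * D) +
      D * (3 * k + 4) := by
  have hD0 : 0 ≤ D := by
    have := (abs_nonneg _).trans (hD 0 x); simpa using this
  -- Greedy covering: from a point of `E` jump by a time `j ≤ k` at which `f j ≤ j α`; from any
  -- other point jump by one step, at cost `f 1 ≤ 2 D`. Invariance of `α` and `α ≤ ψ` bound each
  -- jump by the sum of `ψ` over the steps it covers.
  set ψ : Ω → ℝ := fun y => if y ∈ E then α y else 2 * D with hψ
  have hψα : ∀ y, α y ≤ ψ y := by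
    intro y; simp only [hψ]; split_ifs
    · exact le_rfl
    · exact (abs_le.1 (hα y)).2
  have hαi : ∀ i y, α (T^[i] y) = α y := by
    intro i y
    induction i with
    | zero => rfl
    | succ i ih => rw [Function.iterate_succ_apply', hαT, ih]
  have step : ∀ j y n, j ≤ n → ∑ i ∈ Finset.range n, ψ (T^[i] y) =
      ∑ i ∈ Finset.range j, ψ (T^[i] y) + ∑ i ∈ Finset.range (n - j), ψ (T^[i] (T^[j] y)) := by
    intro j y n hj
    obtain ⟨m, rfl⟩ := Nat.exists_eq_add_of_le hj
    rw [Finset.sum_range_add, Nat.add_sub_cancel_left]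
    simp only [← Function.iterate_add_apply, add_comm j]
  change f n x ≤ ∑ i ∈ Finset.range n, ψ (T^[i] x) + D * (3 * k + 4)
  induction n using Nat.strong_induction_on generalizing x with
  | _ n ih =>
    -- A final piece of length `n ≤ k + 1` costs at most `D (n + 1) + 2 D n ≤ D (3 k + 4)`.
    by_cases hn : n ≤ k + 1
    · have h1 : (n : ℝ) * (-(2 * D)) ≤ ∑ i ∈ Finset.range n, ψ (T^[i] x) := by
        rw [← nsmul_eq_mul]
        simpa using Finset.card_nsmul_le_sum (Finset.range n) (fun i => ψ (T^[i] x)) (-(2 * D))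
          (fun i _ => (abs_le.1 (hα _)).1.trans (hψα _))
      have h2 := (abs_le.1 (hD n x)).2
      have h3 : (n : ℝ) ≤ k + 1 := by exact_mod_cast hn
      nlinarith
    · push Not at hn
      have key : ∃ j, 1 ≤ j ∧ j ≤ n ∧ f j x ≤ ∑ i ∈ Finset.range j, ψ (T^[i] x) := by
        by_cases hx : x ∈ E
        · obtain ⟨j, h1, h2, h3⟩ := hE x hx
          refine ⟨j, h1, by omega, h3.trans ?_⟩
          rw [← nsmul_eq_mul]
          simpa using Finset.card_nsmul_le_sum (Finset.range j) (fun i => ψ (T^[i] x)) (α x)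
            (fun i _ => by simpa only [hαi i x] using hψα (T^[i] x))
        · refine ⟨1, le_rfl, by omega, ?_⟩
          have := (abs_le.1 (hD 1 x)).2
          simp only [Finset.range_one, Finset.sum_singleton, Function.iterate_zero, id, hψ, hx,
            if_false]
          push_cast at this; linarith
      obtain ⟨j, h1, h2, h3⟩ := key
      have h4 := ih (n - j) (by omega) (T^[j] x)
      have h5 := hsub (n - j) j x
      rw [Nat.sub_add_cancel h2] at h5
      rw [step j x n h2]
      linarith

/-- If `α` is invariant and `f_n ≤ n α` infinitely often along every orbit, then the averages of
the subadditive cocycle `f` are asymptotically bounded by the integral of `α`. -/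
theorem eventually_integral_subadditive_le [MeasurableSpace Ω] {μ : Measure Ω}
    [IsProbabilityMeasure μ] {T : Ω → Ω} (hT : MeasurePreserving T μ μ) {f : ℕ → Ω → ℝ}
    {α : Ω → ℝ} {D : ℝ} (hf : ∀ n, Measurable (f n)) (hαm : Measurable α)
    (hD : ∀ n x, |f n x| ≤ D * (n + 1))
    (hsub : ∀ m n x, f (m + n) x ≤ f m (T^[n] x) + f n x)
    (hα : ∀ x, |α x| ≤ 2 * D) (hαT : ∀ x, α (T x) = α x)
    (hfα : ∀ x, ∃ j : ℕ, 1 ≤ j ∧ f j x ≤ j * α x) {ε : ℝ} (hε : 0 < ε) :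
    ∀ᶠ n : ℕ in atTop, ∫ x, f n x ∂μ ≤ n * (∫ x, α x ∂μ + ε) := by
  classical
  obtain ⟨x₀⟩ : Nonempty Ω := μ.nonempty_of_neZero
  have hD0 : 0 ≤ D := by
    have := (abs_nonneg _).trans (hD 0 x₀); simpa using this
  have hfi : ∀ n, Integrable (f n) μ := fun n =>
    .of_bound (hf n).aestronglyMeasurable (D * (n + 1)) (.of_forall fun x => by simpa using hD n x)
  have hαi : Integrable α μ :=
    .of_bound hαm.aestronglyMeasurable (2 * D) (.of_forall fun x => by simpa using hα x)
  set E : ℕ → Set Ω := fun k => {x | ∃ j, 1 ≤ j ∧ j ≤ k ∧ f j x ≤ j * α x} with hEdef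
  have hEm : ∀ k, MeasurableSet (E k) := by
    intro k
    have : E k = ⋃ j ∈ Set.Icc 1 k, {x | f j x ≤ j * α x} := by
      ext x; simp [hEdef, and_assoc]
    rw [this]
    exact MeasurableSet.biUnion (Set.to_countable _) fun j _ =>
      measurableSet_le (hf j) (measurable_const.mul hαm)
  have hEmono : Antitone fun k => (E k)ᶜ := by
    intro a b hab
    exact compl_subset_compl.2 fun x ⟨j, h1, h2, h3⟩ => ⟨j, h1, h2.trans hab, h3⟩
  have hEinter : ⋂ k, (E k)ᶜ = ∅ := by
    rw [← compl_iUnion, compl_empty_iff, eq_univ_iff_forall]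
    intro x
    obtain ⟨j, h1, h2⟩ := hfα x
    exact mem_iUnion.2 ⟨j, j, h1, le_rfl, h2⟩
  have hlim : Tendsto (fun k => μ.real (E k)ᶜ) atTop (𝓝 0) := by
    have := tendsto_measure_iInter_atTop (μ := μ) (fun k => (hEm k).compl.nullMeasurableSet)
      hEmono ⟨0, measure_ne_top _ _⟩
    rw [hEinter, measure_empty] at this
    simpa [Measure.real, Function.comp_def] using (ENNReal.tendsto_toReal ENNReal.zero_ne_top).comp this
  -- The sets `E k` exhaust the space. Off `E k` the function `ψ` below exceeds `α` by at most `4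
  -- D`, so its integral exceeds that of `α` by less than `ε / 2`.
  obtain ⟨k, hk⟩ : ∃ k, 4 * D * μ.real (E k)ᶜ < ε / 2 := by
    have := hlim.const_mul (4 * D)
    rw [mul_zero] at this
    exact (this.eventually (gt_mem_nhds (half_pos hε))).exists
  set ψ : Ω → ℝ := fun y => if y ∈ E k then α y else 2 * D with hψ
  have hψm : Measurable ψ := Measurable.ite (hEm k) hαm measurable_const
  have hψb : ∀ x, |ψ x| ≤ 2 * D := by
    intro x; simp only [hψ]; split_ifs
    · exact hα x
    · rw [abs_of_nonneg (by positivity)]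
  have hψi : Integrable ψ μ :=
    .of_bound hψm.aestronglyMeasurable (2 * D) (.of_forall fun x => by simpa using hψb x)
  have hψint : ∫ x, ψ x ∂μ ≤ ∫ x, α x ∂μ + ε / 2 := by
    have hle : ∀ x, ψ x ≤ α x + (E k)ᶜ.indicator (fun _ => 4 * D) x := by
      intro x
      by_cases hx : x ∈ E k
      · simp [hψ, hx]
      · have := (abs_le.1 (hα x)).1
        simp only [hψ, hx, if_false, mem_compl_iff, not_false_eq_true, indicator_of_mem]
        linarith
    have hii : Integrable ((E k)ᶜ.indicator (fun _ => 4 * D)) μ :=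
      (integrable_const _).indicator (hEm k).compl
    calc ∫ x, ψ x ∂μ ≤ ∫ x, (α x + (E k)ᶜ.indicator (fun _ => 4 * D) x) ∂μ :=
          integral_mono hψi (hαi.add hii) hle
      _ = ∫ x, α x ∂μ + μ.real (E k)ᶜ * (4 * D) := by
          rw [integral_add hαi hii, integral_indicator_const _ (hEm k).compl, smul_eq_mul]
      _ ≤ _ := by linarith
  have hsum : ∀ n, ∫ x, f n x ∂μ ≤ n * ∫ x, ψ x ∂μ + D * (3 * k + 4) := by
    intro n
    have hTi : ∀ i, Integrable (fun x => ψ (T^[i] x)) μ := fun i =>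
      (hT.iterate i).integrable_comp_of_integrable hψi
    calc ∫ x, f n x ∂μ
        ≤ ∫ x, (∑ i ∈ Finset.range n, ψ (T^[i] x) + D * (3 * k + 4)) ∂μ :=
          integral_mono (hfi n) ((integrable_finsetSum _ fun i _ => hTi i).add
            (integrable_const _)) fun x =>
            subadditive_le_sum_of_hitting hD hsub hα hαT k (E k) (fun x hx => hx) n x
      _ = ∑ i ∈ Finset.range n, ∫ x, ψ (T^[i] x) ∂μ + D * (3 * k + 4) := by
          rw [integral_add (integrable_finsetSum _ fun i _ => hTi i) (integrable_const _),
            integral_finsetSum _ fun i _ => hTi i]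
          simp
      _ = n * ∫ x, ψ x ∂μ + D * (3 * k + 4) := by
          have : ∀ i, ∫ x, ψ (T^[i] x) ∂μ = ∫ x, ψ x ∂μ := by
            intro i
            have h := (hT.iterate i)
            rw [← integral_map h.measurable.aemeasurable (by
              rw [h.map_eq]; exact hψi.aestronglyMeasurable), h.map_eq]
          simp [this]
  obtain ⟨N, hN⟩ := exists_nat_gt (D * (3 * k + 4) / (ε / 2))
  filter_upwards [eventually_ge_atTop N] with n hn
  have h1 : D * (3 * k + 4) ≤ n * (ε / 2) := by
    rw [← div_le_iff₀ (by positivity)]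
    exact hN.le.trans (by exact_mod_cast hn)
  have h2 := hsum n
  have h3 : (n : ℝ) * ∫ x, ψ x ∂μ ≤ n * (∫ x, α x ∂μ + ε / 2) := by gcongr
  linarith

theorem bounded_div_of_linear_bound {f : ℕ → ℝ} {D : ℝ} (hD : ∀ n, |f n| ≤ D * (n + 1)) (n : ℕ) :
    |f n / n| ≤ 2 * D := by
  have hD0 : 0 ≤ D := by
    have := (abs_nonneg _).trans (hD 0); simpa using this
  rcases Nat.eq_zero_or_pos n with rfl | hn
  · simp [hD0]
  · have : (1 : ℝ) ≤ n := by exact_mod_cast hn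
    rw [abs_div, Nat.abs_cast, div_le_iff₀ (by positivity)]
    refine (hD n).trans ?_
    nlinarith

theorem liminf_le_liminf_of_eventually_le_add {ι : Type*} {l : Filter ι} [l.NeBot] {u v : ι → ℝ}
    {a : ℝ} (hu : ∀ᶠ i in l, |u i| ≤ a) (hv : ∀ᶠ i in l, |v i| ≤ a)
    (h : ∀ ε > 0, ∀ᶠ i in l, u i ≤ v i + ε) : liminf u l ≤ liminf v l := by
  have hub : IsBoundedUnder (· ≥ ·) l u :=
    isBoundedUnder_of_eventually_ge (a := -a) (hu.mono fun i hi => (abs_le.1 hi).1)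
  have hvc : IsCoboundedUnder (· ≥ ·) l v :=
    (isBoundedUnder_of_eventually_le (a := a)
      (hv.mono fun i hi => (abs_le.1 hi).2)).isCoboundedUnder_ge
  refine le_of_forall_lt fun c hc => ?_
  obtain ⟨c', hc1, hc2⟩ := exists_between hc
  obtain ⟨c₁, hc3, hc4⟩ := exists_between hc1
  refine hc3.trans_le (le_liminf_of_le hvc ?_)
  filter_upwards [eventually_lt_of_lt_liminf hc2 hub, h (c' - c₁) (sub_pos.2 hc4)] with i h1 h2
  linarith

theorem liminf_eq_of_tendsto_sub {ι : Type*} {l : Filter ι} [l.NeBot] {u v : ι → ℝ}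
    {a : ℝ} (hu : ∀ᶠ i in l, |u i| ≤ a) (hv : ∀ᶠ i in l, |v i| ≤ a)
    (h : Tendsto (fun i => u i - v i) l (𝓝 0)) : liminf u l = liminf v l := by
  refine le_antisymm (liminf_le_liminf_of_eventually_le_add hu hv fun ε hε => ?_)
    (liminf_le_liminf_of_eventually_le_add hv hu fun ε hε => ?_)
  · filter_upwards [h.eventually (gt_mem_nhds hε)] with i hi
    linarith
  · filter_upwards [h.eventually (lt_mem_nhds (neg_lt_zero.2 hε))] with i hi
    linarith

/-- With `a n = f n (T x)` and `b n = f n x`, this makes the lower growth rate of a cocycle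
invariant under `T` at every point. -/
theorem liminf_div_eq_of_shift {a b : ℕ → ℝ} {C D : ℝ} (ha : ∀ n, |a n| ≤ D * (n + 1))
    (hb : ∀ n, |b n| ≤ D * (n + 1)) (h : ∀ n, |a n - b (n + 1)| ≤ C) :
    liminf (fun n : ℕ => a n / n) atTop = liminf (fun n : ℕ => b n / n) atTop := by
  rw [← liminf_nat_add (fun n : ℕ => b n / n) 1]
  refine liminf_eq_of_tendsto_sub (a := 2 * D) (.of_forall (bounded_div_of_linear_bound ha))
    (.of_forall fun n => bounded_div_of_linear_bound hb (n + 1)) ?_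
  have hlim : Tendsto (fun n : ℕ => (C + 2 * D) / n) atTop (𝓝 0) :=
    tendsto_const_div_atTop_nhds_zero_nat _
  refine squeeze_zero_norm' ?_ hlim
  filter_upwards [eventually_ge_atTop 1] with n hn
  have hn0 : (0 : ℝ) < n := by exact_mod_cast hn
  have e : a n / n - b (n + 1) / (n + 1 : ℕ) =
      ((a n - b (n + 1)) + b (n + 1) / (n + 1 : ℕ)) / n := by
    push_cast; field_simp; ring
  rw [e, Real.norm_eq_abs, abs_div, Nat.abs_cast]
  gcongr
  exact (abs_add_le _ _).trans (add_le_add (h n) (bounded_div_of_linear_bound hb (n + 1)))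

theorem abs_liminf_le {ι : Type*} {l : Filter ι} [l.NeBot] {u : ι → ℝ} {a : ℝ}
    (hu : ∀ᶠ i in l, |u i| ≤ a) : |liminf u l| ≤ a := by
  have h1 := isBoundedUnder_of_eventually_ge (a := -a) (hu.mono fun i hi => (abs_le.1 hi).1)
  have h2 := isBoundedUnder_of_eventually_le (a := a) (hu.mono fun i hi => (abs_le.1 hi).2)
  refine abs_le.2 ⟨le_liminf_of_le h2.isCoboundedUnder_ge (hu.mono fun i hi => (abs_le.1 hi).1),
    liminf_le_of_frequently_le (Eventually.frequently (hu.mono fun i hi => (abs_le.1 hi).2)) h1⟩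

/-- The part of the subadditive ergodic theorem that bounds the averages of a subadditive cocycle by
the integral of its lower growth rate. -/
theorem eventually_integral_le_integral_liminf [MeasurableSpace Ω] {μ : Measure Ω}
    [IsProbabilityMeasure μ] {T : Ω → Ω} (hT : MeasurePreserving T μ μ) {f : ℕ → Ω → ℝ}
    {C D : ℝ} (hf : ∀ n, Measurable (f n))
    (hD : ∀ n x, |f n x| ≤ D * (n + 1))
    (hsub : ∀ m n x, f (m + n) x ≤ f m (T^[n] x) + f n x)
    (hlow : ∀ n x, f n (T x) ≤ f (n + 1) x + C)
    {ε : ℝ} (hε : 0 < ε) :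
    ∀ᶠ n : ℕ in atTop,
      ∫ x, f n x ∂μ ≤ n * (∫ x, liminf (fun m : ℕ => f m x / m) atTop ∂μ + ε) := by
  obtain ⟨x₀⟩ : Nonempty Ω := μ.nonempty_of_neZero
  set F : Ω → ℝ := fun x => liminf (fun m : ℕ => f m x / m) atTop with hF
  have hb : ∀ n x, |f n x / n| ≤ 2 * D := fun n x =>
    bounded_div_of_linear_bound (fun n => hD n x) n
  have hFb : ∀ x, |F x| ≤ 2 * D := fun x => abs_liminf_le (.of_forall fun n => hb n x)
  have hFm : Measurable F := .liminf fun n => (hf n).div_const _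
  have hFi : Integrable F μ :=
    .of_bound hFm.aestronglyMeasurable (2 * D) (.of_forall fun x => by simpa using hFb x)
  have hFT : ∀ x, F (T x) = F x := by
    intro x
    refine liminf_div_eq_of_shift (C := |C| + 2 * D) (fun n => hD n _) (fun n => hD n _) fun n => ?_
    have h1 := hlow n x
    have h2 := hsub n 1 x
    have h3 := hD 1 x
    rw [abs_le] at h3 ⊢
    rw [Function.iterate_one] at h2
    push_cast at h3
    have h4 := le_abs_self C
    have h5 := abs_nonneg C
    have h6 : 0 ≤ D := by
      have := (abs_nonneg _).trans (hD 0 x₀); simpa using this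
    constructor <;> linarith
  -- Adding `ε / 2` to the liminf makes the inequality `f j ≤ j α` occur at some `j ≥ 1` on every
  -- orbit; `D` is enlarged to keep `|α| ≤ 2 D`.
  have key := eventually_integral_subadditive_le (α := fun x => F x + ε / 2) (D := D + ε / 2) hT hf
    (hFm.add_const _) (fun n x => (hD n x).trans (by gcongr; linarith)) hsub
    (fun x => ?_) (fun x => by rw [hFT]) (fun x => ?_) (half_pos hε)
  · filter_upwards [key] with n hn
    refine hn.trans_eq ?_
    rw [integral_add hFi (integrable_const _)]
    simp only [integral_const, probReal_univ, one_smul]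
    ring
  · refine (abs_add_le _ _).trans ?_
    rw [abs_of_pos (half_pos hε)]
    linarith [hFb x]
  · have hfr : ∃ᶠ m : ℕ in atTop, f m x / m < F x + ε / 2 :=
      frequently_lt_of_liminf_lt (isBoundedUnder_of_eventually_le (a := 2 * D)
        (.of_forall fun n => (abs_le.1 (hb n x)).2)).isCoboundedUnder_ge (by
          change F x < _; linarith)
    obtain ⟨j, hj, hj1⟩ := (hfr.and_eventually (eventually_ge_atTop 1)).exists
    refine ⟨j, hj1, ?_⟩
    rw [div_lt_iff₀ (by exact_mod_cast hj1)] at hj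
    linarith

end Subadditive

/-! ### Semiflows on compact spaces and subadditive cocycles over them -/

section Semiflow

/-- `ψ t`, `t ≥ 0`, is a continuous semiflow. The values for `t < 0` are irrelevant. -/
structure IsSemiflow {Y : Type*} [TopologicalSpace Y] (ψ : ℝ → Y → Y) : Prop where
  map_zero : ∀ x, ψ 0 x = x
  map_add : ∀ s t : ℝ, 0 ≤ s → 0 ≤ t → ∀ x, ψ (s + t) x = ψ s (ψ t x)
  continuousOn : ContinuousOn (fun p : ℝ × Y => ψ p.1 p.2) (Ici 0 ×ˢ univ)

/-- `f` is a continuous subadditive cocycle over the semiflow `ψ` that satisfies a reverse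
inequality for steps of length at most one. -/
structure IsSubadditiveCocycle {Y : Type*} [TopologicalSpace Y] (ψ : ℝ → Y → Y)
    (f : ℝ → Y → ℝ) : Prop where
  continuousOn : ContinuousOn (fun p : ℝ × Y => f p.1 p.2) (Ici 0 ×ˢ univ)
  subadd : ∀ s t : ℝ, 0 ≤ s → 0 ≤ t → ∀ x, f (s + t) x ≤ f s (ψ t x) + f t x
  le_shift : ∃ C, ∀ s t : ℝ, 0 ≤ s → s ≤ 1 → 0 ≤ t → ∀ x, f t (ψ s x) ≤ f (t + s) x + C

variable {Y : Type*} [TopologicalSpace Y] {ψ : ℝ → Y → Y} {f g : ℝ → Y → ℝ}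

theorem IsSemiflow.continuous (hψ : IsSemiflow ψ) {t : ℝ} (ht : 0 ≤ t) : Continuous (ψ t) := by
  rw [← continuousOn_univ]
  exact hψ.continuousOn.comp (f := fun x : Y => (t, x)) (by fun_prop) fun x _ => ⟨ht, mem_univ _⟩

theorem IsSemiflow.continuous_orbit (hψ : IsSemiflow ψ) (x : Y) :
    Continuous fun s : ℝ => ψ (max s 0) x := by
  rw [← continuousOn_univ]
  exact hψ.continuousOn.comp (f := fun s : ℝ => (max s 0, x)) (by fun_prop)
    fun s _ => ⟨le_max_right s 0, mem_univ _⟩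

theorem IsSemiflow.iterate (hψ : IsSemiflow ψ) (n : ℕ) (x : Y) : (ψ 1)^[n] x = ψ n x := by
  induction n with
  | zero => simp [hψ.map_zero]
  | succ n ih =>
    rw [Function.iterate_succ_apply', ih, ← hψ.map_add 1 n zero_le_one n.cast_nonneg]
    push_cast; rw [add_comm]

namespace IsSubadditiveCocycle

theorem continuous (hf : IsSubadditiveCocycle ψ f) {t : ℝ} (ht : 0 ≤ t) : Continuous (f t) := by
  rw [← continuousOn_univ]
  exact hf.continuousOn.comp (f := fun x : Y => (t, x)) (by fun_prop) fun x _ => ⟨ht, mem_univ _⟩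

theorem add (hf : IsSubadditiveCocycle ψ f) (hg : IsSubadditiveCocycle ψ g) :
    IsSubadditiveCocycle ψ fun t x => f t x + g t x where
  continuousOn := hf.continuousOn.add hg.continuousOn
  subadd s t hs ht x := by linarith [hf.subadd s t hs ht x, hg.subadd s t hs ht x]
  le_shift := by
    obtain ⟨C, hC⟩ := hf.le_shift
    obtain ⟨C', hC'⟩ := hg.le_shift
    exact ⟨C + C', fun s t hs hs1 ht x => by linarith [hC s t hs hs1 ht x, hC' s t hs hs1 ht x]⟩

/-- Times in `[0, 1]` are handled by compactness. Each further unit of time changes the bound by a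
constant: above by subadditivity, below by `le_shift`. -/
theorem exists_linear_bound [CompactSpace Y] (hf : IsSubadditiveCocycle ψ f) :
    ∃ D, 0 < D ∧ ∀ t : ℝ, 0 ≤ t → ∀ x, |f t x| ≤ D * (t + 1) := by
  obtain ⟨B, hB⟩ := (isCompact_Icc.prod isCompact_univ).exists_bound_of_continuousOn
    (hf.continuousOn.mono (prod_mono (Icc_subset_Ici_self : Icc (0 : ℝ) 1 ⊆ Ici 0) subset_rfl))
  obtain ⟨C, hC⟩ := hf.le_shift
  have hB' : ∀ t x, 0 ≤ t → t ≤ 1 → |f t x| ≤ |B| := fun t x h0 h1 =>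
    (hB (t, x) ⟨⟨h0, h1⟩, mem_univ _⟩).trans (le_abs_self B)
  refine ⟨|B| + |C| + 1, by positivity, fun t ht x => ?_⟩
  have key : ∀ (n : ℕ) (t : ℝ), 0 ≤ t → t ≤ n + 1 → ∀ x, |f t x| ≤ |B| + n * (|B| + |C|) := by
    intro n
    induction n with
    | zero =>
      intro t h0 h1 x
      simpa using hB' t x h0 (by simpa using h1)
    | succ n ih =>
      intro t h0 h1 x
      push_cast at h1 ⊢
      by_cases h : t ≤ n + 1
      · have := ih t h0 h x
        nlinarith [abs_nonneg B, abs_nonneg C]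
      · push Not at h
        have hn : (0 : ℝ) ≤ n := n.cast_nonneg
        have h2 := ih (t - 1) (by linarith) (by linarith) (ψ 1 x)
        have h3 := hf.subadd (t - 1) 1 (by linarith) zero_le_one x
        have h4 := hC 1 (t - 1) zero_le_one le_rfl (by linarith) x
        have h5 := hB' 1 x zero_le_one le_rfl
        rw [sub_add_cancel] at h3 h4
        rw [abs_le] at h2 h5 ⊢
        constructor <;> linarith [le_abs_self C, abs_nonneg C, abs_nonneg B]
  have h1 := key ⌊t⌋₊ t ht (Nat.lt_floor_add_one t).le x
  have h2 := Nat.floor_le ht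
  refine h1.trans ?_
  nlinarith [abs_nonneg B, abs_nonneg C]

/-- If every orbit has a time at which a subadditive cocycle is negative, then the cocycle
decreases linearly, uniformly on the compact space. -/
theorem exists_linear_decay [CompactSpace Y] (hf : IsSubadditiveCocycle ψ f)
    (hneg : ∀ x, ∃ n : ℕ, 1 ≤ n ∧ f n x < 0) :
    ∃ K r : ℝ, 0 < r ∧ ∀ t : ℝ, 0 ≤ t → ∀ x, f t x ≤ K - r * t := by
  obtain ⟨D, hD0, hD⟩ := hf.exists_linear_bound
  -- One index controls both the waiting time and the size of the drop, so the open sets `U N`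
  -- increase and compactness yields a single `N`.
  set U : ℕ → Set Y := fun N => {x | ∃ n : ℕ, 1 ≤ n ∧ n ≤ N + 1 ∧ f n x < -(1 / (N + 1))} with hU
  have hUo : ∀ N, IsOpen (U N) := by
    intro N
    have : U N = ⋃ n ∈ Set.Icc 1 (N + 1), {x | f n x < -(1 / ((N : ℝ) + 1))} := by
      ext x; simp [hU, and_assoc]
    rw [this]
    exact isOpen_biUnion fun n _ => isOpen_lt (hf.continuous n.cast_nonneg) continuous_const
  have hUmono : Monotone U := by
    intro a b hab x ⟨n, h1, h2, h3⟩
    refine ⟨n, h1, by omega, h3.trans_le ?_⟩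
    have : (a : ℝ) ≤ b := by exact_mod_cast hab
    have : 1 / ((b : ℝ) + 1) ≤ 1 / (a + 1) := by gcongr
    linarith
  have hUcover : (univ : Set Y) ⊆ ⋃ N, U N := by
    intro x _
    obtain ⟨n, h1, h2⟩ := hneg x
    obtain ⟨N, hN⟩ := exists_nat_one_div_lt (neg_pos.2 h2)
    refine mem_iUnion.2 ⟨max n N, n, h1, by omega, ?_⟩
    have : (N : ℝ) ≤ (max n N : ℕ) := by exact_mod_cast le_max_right n N
    have : 1 / (((max n N : ℕ) : ℝ) + 1) ≤ 1 / ((N : ℝ) + 1) := by gcongr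
    linarith
  obtain ⟨N, hN⟩ := isCompact_univ.elim_directed_cover U hUo hUcover hUmono.directed_le
  set δ : ℝ := 1 / (N + 1) with hδ
  have hδ0 : 0 < δ := by positivity
  have hN0 : (0 : ℝ) < N + 1 := by positivity
  refine ⟨D * (N + 2) + δ, δ / (N + 1), by positivity, fun t ht x => ?_⟩
  -- Peel off drops of at least `δ`, each taking time at most `N + 1`: the rate is `δ / (N + 1)`.
  -- The last stretch, shorter than `N + 1`, is absorbed in the constant.
  have key : ∀ (k : ℕ) (t : ℝ), 0 ≤ t → t < k → ∀ x,
      f t x ≤ D * (N + 2) + δ - δ / (N + 1) * t := by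
    intro k
    induction k with
    | zero => intro t h0 h1; norm_num at h1; linarith
    | succ k ih =>
      intro t h0 h1 x
      by_cases h : t < N + 1
      · have h2 := (abs_le.1 (hD t h0 x)).2
        have h3 : δ / (N + 1) * t ≤ δ := by
          rw [div_mul_eq_mul_div, div_le_iff₀ hN0]
          exact mul_le_mul_of_nonneg_left h.le hδ0.le
        nlinarith
      · push Not at h
        obtain ⟨n, hn1, hn2, hn3⟩ := hN (mem_univ x)
        have hn2' : (n : ℝ) ≤ N + 1 := by exact_mod_cast hn2
        have hn1' : (1 : ℝ) ≤ n := by exact_mod_cast hn1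
        push_cast at h1
        have h4 := ih (t - n) (by linarith) (by linarith) (ψ n x)
        have h5 := hf.subadd (t - n) n (by linarith) n.cast_nonneg x
        rw [sub_add_cancel] at h5
        have h6 : δ / (N + 1) * n ≤ δ := by
          rw [div_mul_eq_mul_div, div_le_iff₀ hN0]
          exact mul_le_mul_of_nonneg_left hn2' hδ0.le
        linarith
  exact key (⌊t⌋₊ + 1) t ht (by push_cast; exact Nat.lt_floor_add_one t) x

/-- Comparison of a subadditive cocycle at time `(k + 1) m` with the integral of its time `m` map
along the orbit. -/
theorem mul_le_integral_orbit [CompactSpace Y] (hψ : IsSemiflow ψ)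
    (hf : IsSubadditiveCocycle ψ f) {D : ℝ} (hD : ∀ t : ℝ, 0 ≤ t → ∀ x, |f t x| ≤ D * (t + 1))
    {m : ℝ} (hm : 0 < m) (k : ℕ) (x : Y) :
    m * f ((k + 1) * m) x ≤
      D * (m + 3) * m + ∫ s in (0 : ℝ)..(k * m), f m (ψ (max s 0) x) := by
  have hcont : Continuous fun s : ℝ => f m (ψ (max s 0) x) :=
    (hf.continuous hm.le).comp (hψ.continuous_orbit x)
  have hsum : ∀ (k : ℕ) y, f (k * m) y ≤ D + ∑ j ∈ Finset.range k, f m (ψ (j * m) y) := by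
    intro k
    induction k with
    | zero =>
      intro y
      simpa using (abs_le.1 (hD 0 le_rfl y)).2
    | succ k ih =>
      intro y
      have h1 := hf.subadd m (k * m) hm.le (by positivity) y
      rw [Finset.sum_range_succ, show ((k + 1 : ℕ) : ℝ) * m = m + k * m by push_cast; ring]
      linarith [ih y]
  -- Cut `(k + 1) m` into an initial piece `s`, `k` blocks of length `m` and a final piece `m - s`.
  -- Integrated over `s ∈ [0, m]`, the block terms tile `[0, k m]`. The end pieces and `f 0`
  -- contribute `D (m + 3)`.
  have hpt : ∀ s ∈ Icc 0 m, f ((k + 1) * m) x ≤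
      D * (m + 3) + ∑ j ∈ Finset.range k, f m (ψ (max (s + j * m) 0) x) := by
    intro s ⟨hs0, hsm⟩
    have h1 := hf.subadd (m - s + k * m) s (by nlinarith [k.cast_nonneg (α := ℝ)]) hs0 x
    have h2 := hf.subadd (m - s) (k * m) (by linarith) (by positivity) (ψ s x)
    have h3 := (abs_le.1 (hD s hs0 x)).2
    have h4 := (abs_le.1 (hD (m - s) (by linarith) (ψ (k * m) (ψ s x)))).2
    have h5 := hsum k (ψ s x)
    have h6 : ∀ j : ℕ, ψ (max (s + j * m) 0) x = ψ (j * m) (ψ s x) := by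
      intro j
      have : 0 ≤ j * m := by positivity
      rw [max_eq_left (by positivity), add_comm, hψ.map_add _ _ this hs0]
    simp only [h6]
    rw [show m - s + k * m + s = (k + 1) * m by ring] at h1
    linarith
  have hi : ∀ j : ℕ, Continuous fun s : ℝ => f m (ψ (max (s + j * m) 0) x) := fun j =>
    hcont.comp (continuous_id.add continuous_const)
  have hint := intervalIntegral.integral_mono_on (μ := volume) hm.le
    (continuous_const.intervalIntegrable _ _)
    ((continuous_const.add (continuous_finsetSum (Finset.range k) fun j _ =>
      hi j)).intervalIntegrable 0 m) hpt
  simp only [Pi.add_apply] at hint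
  rw [intervalIntegral.integral_const, intervalIntegral.integral_add
    (continuous_const.intervalIntegrable _ _)
    ((continuous_finsetSum (Finset.range k) fun j _ => hi j).intervalIntegrable 0 m),
    intervalIntegral.integral_const, intervalIntegral.integral_finsetSum
    (fun j _ => (hi j).intervalIntegrable 0 m), sub_zero, smul_eq_mul, smul_eq_mul] at hint
  have hadj : ∑ j ∈ Finset.range k, ∫ s in (0 : ℝ)..m, f m (ψ (max (s + j * m) 0) x) =
      ∫ s in (0 : ℝ)..(k * m), f m (ψ (max s 0) x) := by
    have := intervalIntegral.sum_integral_adjacent_intervals (n := k) (a := fun j : ℕ => j * m)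
      (μ := volume) (f := fun s : ℝ => f m (ψ (max s 0) x))
      fun j _ => hcont.intervalIntegrable _ _
    simp only [Nat.cast_zero, zero_mul] at this
    rw [← this]
    refine Finset.sum_congr rfl fun j _ => ?_
    rw [intervalIntegral.integral_comp_add_right (fun s => f m (ψ (max s 0) x)), zero_add]
    congr 1
    push_cast; ring
  rw [hadj] at hint
  linarith

end IsSubadditiveCocycle

end Semiflow

/-! ### Invariant measures from orbits -/

section KrylovBogoliubov

variable {Y : Type*} [TopologicalSpace Y] [CompactSpace Y] [T2Space Y]
  [MeasurableSpace Y] [BorelSpace Y]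

/-- The space of probability measures on `Y` is compact, so the images under `c` of the uniform
measures on `(0, N + 1]` converge along any ultrafilter; a nonprincipal one replaces the choice of a
subsequence. -/
theorem exists_limit_of_orbit_averages {c : ℝ → Y} (hc : Continuous c) :
    ∃ (μ : Measure Y) (U : Filter ℕ), IsProbabilityMeasure μ ∧ U.NeBot ∧ U ≤ atTop ∧
      ∀ u : Y → ℝ, Continuous u →
        Tendsto (fun N : ℕ => (N + 1 : ℝ)⁻¹ * ∫ s in (0 : ℝ)..(N + 1), u (c s)) U
          (𝓝 (∫ y, u y ∂μ)) := by
  have hpos : ∀ N : ℕ, (volume (Ioc (0 : ℝ) (N + 1))) ≠ 0 := fun N => by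
    rw [Real.volume_Ioc, sub_zero, Ne, ENNReal.ofReal_eq_zero, not_le]; positivity
  have hprob : ∀ N : ℕ, IsProbabilityMeasure
      ((ProbabilityTheory.cond volume (Ioc (0 : ℝ) (N + 1))).map c) := fun N => by
    have := ProbabilityTheory.cond_isProbabilityMeasure_of_finite (hpos N) (by simp)
    exact Measure.isProbabilityMeasure_map hc.measurable.aemeasurable
  set P : ℕ → ProbabilityMeasure Y := fun N => ⟨_, hprob N⟩ with hP
  obtain ⟨μ, hμ⟩ : ∃ μ, Tendsto P (hyperfilter ℕ : Ultrafilter ℕ) (𝓝 μ) :=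
    ⟨((hyperfilter ℕ).map P).lim, ((hyperfilter ℕ).map P).le_nhds_lim⟩
  refine ⟨μ, (hyperfilter ℕ : Ultrafilter ℕ), inferInstance, inferInstance, ?_, fun u hu => ?_⟩
  · rw [← Nat.cofinite_eq_atTop]; exact hyperfilter_le_cofinite
  · have := ProbabilityMeasure.tendsto_iff_forall_integral_tendsto.1 hμ
      (BoundedContinuousFunction.mkOfCompact ⟨u, hu⟩)
    refine this.congr fun N => ?_
    simp only [hP, ProbabilityMeasure.coe_mk, BoundedContinuousFunction.mkOfCompact_apply,
      ContinuousMap.coe_mk]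
    rw [integral_map hc.measurable.aemeasurable hu.aestronglyMeasurable,
      ProbabilityTheory.cond, integral_smul_measure,
      intervalIntegral.integral_of_le (by positivity), Real.volume_Ioc, sub_zero,
      ENNReal.toReal_inv, ENNReal.toReal_ofReal (by positivity), smul_eq_mul]

theorem abs_integral_orbit_shift_le {v : ℝ → ℝ} (hv : Continuous v) {B : ℝ} (hB : ∀ s, |v s| ≤ B)
    {t : ℝ} (ht : 0 ≤ t) (N : ℝ) :
    |(∫ s in (0 : ℝ)..N, v (s + t)) - ∫ s in (0 : ℝ)..N, v s| ≤ 2 * B * t := by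
  have hi : ∀ a b : ℝ, IntervalIntegrable v volume a b := fun a b => hv.intervalIntegrable a b
  rw [intervalIntegral.integral_comp_add_right, zero_add,
    intervalIntegral.integral_interval_sub_interval_comm' (hi _ _) (hi _ _) (hi _ _)]
  have h1 : ‖∫ s in N..(N + t), v s‖ ≤ B * |N + t - N| :=
    intervalIntegral.norm_integral_le_of_norm_le_const fun s _ => hB s
  have h2 : ‖∫ s in (0 : ℝ)..t, v s‖ ≤ B * |t - 0| :=
    intervalIntegral.norm_integral_le_of_norm_le_const fun s _ => hB s
  rw [Real.norm_eq_abs, add_sub_cancel_left, abs_of_nonneg ht] at h1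
  rw [Real.norm_eq_abs, sub_zero, abs_of_nonneg ht] at h2
  refine (abs_sub _ _).trans ?_
  linarith

/-- An orbit along which a subadditive cocycle is never negative yields an invariant probability
measure for which all integrals of the cocycle are nonnegative. -/
theorem IsSubadditiveCocycle.exists_invariant_measure [SecondCountableTopology Y]
    {ψ : ℝ → Y → Y} {f : ℝ → Y → ℝ} (hψ : IsSemiflow ψ) (hf : IsSubadditiveCocycle ψ f) (x : Y)
    (hx : ∀ n : ℕ, 1 ≤ n → 0 ≤ f n x) :
    ∃ μ : Measure Y, IsProbabilityMeasure μ ∧ (∀ t : ℝ, 0 ≤ t → MeasurePreserving (ψ t) μ μ) ∧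
      ∀ m : ℕ, 1 ≤ m → 0 ≤ ∫ y, f m y ∂μ := by
  obtain ⟨D, hD0, hD⟩ := hf.exists_linear_bound
  have hc := hψ.continuous_orbit x
  obtain ⟨μ, U, hμ, hU, hUle, hlim⟩ := exists_limit_of_orbit_averages hc
  have hinv : ∀ C : ℝ, Tendsto (fun N : ℕ => (N + 1 : ℝ)⁻¹ * C) U (𝓝 0) := by
    intro C
    have h1 : Tendsto (fun N : ℕ => ((N : ℝ) + 1)⁻¹) atTop (𝓝 0) := by
      simpa [one_div] using tendsto_one_div_add_atTop_nhds_zero_nat (𝕜 := ℝ)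
    simpa using (h1.mono_left hUle).mul_const C
  refine ⟨μ, hμ, fun t ht => ⟨(hψ.continuous ht).measurable, ?_⟩, fun m hm => ?_⟩
  · have hm := (hψ.continuous ht).measurable
    have : IsProbabilityMeasure (μ.map (ψ t)) := Measure.isProbabilityMeasure_map hm.aemeasurable
    refine ext_of_forall_integral_eq_of_IsFiniteMeasure fun u => ?_
    rw [integral_map hm.aemeasurable u.continuous.aestronglyMeasurable]
    have h1 := hlim (fun y => u (ψ t y)) (u.continuous.comp (hψ.continuous ht))
    have h2 := hlim u u.continuous
    -- Composing with `ψ t` shifts the averaging window by `t`, which alters the integral by at most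
    -- `2 ‖u‖ t`; after division by `N + 1` this vanishes.
    have hshift : ∀ N : ℕ, ∫ s in (0 : ℝ)..(N + 1), u (ψ t (ψ (max s 0) x)) =
        ∫ s in (0 : ℝ)..(N + 1), u (ψ (max (s + t) 0) x) := by
      intro N
      refine intervalIntegral.integral_congr fun s hs => ?_
      rw [uIcc_of_le (by positivity)] at hs
      have hs0 : 0 ≤ s := hs.1
      rw [max_eq_left hs0, max_eq_left (by positivity), add_comm, hψ.map_add t s ht hs0]
    simp only [hshift] at h1
    refine sub_eq_zero.1 (tendsto_nhds_unique (h1.sub h2) ?_)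
    refine squeeze_zero_norm (fun N => ?_) (hinv (2 * ‖u‖ * t))
    rw [← mul_sub, norm_mul, Real.norm_of_nonneg (by positivity)]
    exact mul_le_mul_of_nonneg_left (abs_integral_orbit_shift_le
      (v := fun s => u (ψ (max s 0) x)) (u.continuous.comp hc) (fun s => u.norm_coe_le_norm _)
      ht _) (by positivity)
  · have hm0 : (0 : ℝ) < m := by exact_mod_cast hm
    have hcont : Continuous fun s : ℝ => f m (ψ (max s 0) x) := (hf.continuous hm0.le).comp hc
    -- Nonnegativity of `f` at the integer time `(k + 1) m` bounds the integral over `[0, k m]`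
    -- below; the remainder has length at most `m`. The bound does not depend on `N`, so the limit
    -- of the averages is nonnegative.
    have hlow : ∀ N : ℕ, -(D * (m + 3) * m + D * (m + 1) * m) ≤
        ∫ s in (0 : ℝ)..(N + 1), f m (ψ (max s 0) x) := by
      intro N
      set k := (N + 1) / m with hk
      have hk1 : (k : ℝ) * m ≤ N + 1 := by exact_mod_cast Nat.div_mul_le_self (N + 1) m
      have hk2 : (N : ℝ) + 1 ≤ k * m + m := by
        have := (Nat.lt_div_mul_add (a := N + 1) (b := m) hm).le
        exact_mod_cast this
      have h1 := mul_le_integral_orbit hψ hf hD hm0 k x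
      have h2 : 0 ≤ f ((k + 1) * m) x := by
        have := hx ((k + 1) * m) (Nat.mul_pos k.succ_pos hm)
        exact_mod_cast this
      have h3 : ‖∫ s in (k * m : ℝ)..(N + 1), f m (ψ (max s 0) x)‖ ≤
          D * (m + 1) * |(N + 1 : ℝ) - k * m| :=
        intervalIntegral.norm_integral_le_of_norm_le_const fun s _ => hD m hm0.le _
      rw [abs_of_nonneg (by linarith), Real.norm_eq_abs] at h3
      have h4 : D * (m + 1) * ((N + 1 : ℝ) - k * m) ≤ D * (m + 1) * m := by
        gcongr; linarith
      have h5 := (abs_le.1 (h3.trans h4)).1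
      rw [← intervalIntegral.integral_add_adjacent_intervals (b := k * m)
        (hcont.intervalIntegrable _ _) (hcont.intervalIntegrable _ _)]
      have h6 := mul_nonneg hm0.le h2
      linarith
    refine le_of_tendsto_of_tendsto' (hinv _) (hlim _ (hf.continuous hm0.le)) fun N =>
      mul_le_mul_of_nonneg_left (hlow N) (by positivity)

/-- If, for every invariant probability measure, the sum of the lower growth rates of two
subadditive cocycles is almost everywhere at most a negative constant, then the sum of the cocycles
decreases linearly, uniformly on the compact space. -/
theorem IsSubadditiveCocycle.exists_linear_decay_of_ae [SecondCountableTopology Y]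
    {ψ : ℝ → Y → Y} {f g : ℝ → Y → ℝ} (hψ : IsSemiflow ψ) (hf : IsSubadditiveCocycle ψ f)
    (hg : IsSubadditiveCocycle ψ g) {η : ℝ} (hη : η < 0)
    (h : ∀ μ : Measure Y, IsProbabilityMeasure μ →
      (∀ t : ℝ, 0 ≤ t → MeasurePreserving (ψ t) μ μ) →
      ∀ᵐ x ∂μ, liminf (fun n : ℕ => f n x / n) atTop + liminf (fun n : ℕ => g n x / n) atTop ≤ η) :
    ∃ K r : ℝ, 0 < r ∧ ∀ t : ℝ, 0 ≤ t → ∀ x, f t x + g t x ≤ K - r * t := by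
  refine (hf.add hg).exists_linear_decay ?_
  by_contra! hcon
  obtain ⟨x, hx⟩ := hcon
  obtain ⟨μ, hμ, hinv, hpos⟩ := (hf.add hg).exists_invariant_measure hψ x hx
  -- The ergodic bound is applied to each cocycle separately, because the hypothesis controls the
  -- sum of the two liminfs, which may be smaller than the liminf of the sum.
  have rate : ∀ {f : ℝ → Y → ℝ}, IsSubadditiveCocycle ψ f → ∀ {ε : ℝ}, 0 < ε →
      ∀ᶠ n : ℕ in atTop,
        ∫ x, f n x ∂μ ≤ n * (∫ x, liminf (fun m : ℕ => f m x / m) atTop ∂μ + ε) := by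
    intro f hf ε hε
    obtain ⟨D, hD0, hD⟩ := hf.exists_linear_bound
    obtain ⟨C, hC⟩ := hf.le_shift
    refine eventually_integral_le_integral_liminf (f := fun n : ℕ => f n) (C := C) (D := D)
      (hinv 1 zero_le_one)
      (fun n => (hf.continuous n.cast_nonneg).measurable) (fun n => hD n n.cast_nonneg)
      (fun m n x => ?_) (fun n x => ?_) hε
    · rw [hψ.iterate]
      simpa using hf.subadd m n m.cast_nonneg n.cast_nonneg x
    · simpa using hC 1 n zero_le_one le_rfl n.cast_nonneg x
  have hint : ∀ {f : ℝ → Y → ℝ}, IsSubadditiveCocycle ψ f →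
      Integrable (fun x => liminf (fun m : ℕ => f m x / m) atTop) μ := by
    intro f hf
    obtain ⟨D, hD0, hD⟩ := hf.exists_linear_bound
    refine .of_bound (Measurable.liminf fun n : ℕ =>
      (hf.continuous n.cast_nonneg).measurable.div_const _).aestronglyMeasurable (2 * D)
      (.of_forall fun x => abs_liminf_le (.of_forall fun n => ?_))
    exact bounded_div_of_linear_bound (fun n : ℕ => hD n n.cast_nonneg x) n
  have hfi : ∀ {f : ℝ → Y → ℝ}, IsSubadditiveCocycle ψ f → ∀ n : ℕ, Integrable (f n) μ := by
    intro f hf n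
    obtain ⟨D, hD0, hD⟩ := hf.exists_linear_bound
    exact .of_bound (hf.continuous n.cast_nonneg).aestronglyMeasurable (D * (n + 1))
      (.of_forall fun x => hD n n.cast_nonneg x)
  have hle : ∫ x, liminf (fun m : ℕ => f m x / m) atTop ∂μ +
      ∫ x, liminf (fun m : ℕ => g m x / m) atTop ∂μ ≤ η := by
    rw [← integral_add (hint hf) (hint hg)]
    refine (integral_mono_ae ((hint hf).add (hint hg)) (integrable_const η) (h μ hμ hinv)).trans ?_
    simp
  -- Two errors of `-η / 4` leave `∫ (f_n + g_n) ≤ n η / 2 < 0`.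
  obtain ⟨n, ⟨h1, h2⟩, h3⟩ := (((rate hf (ε := -η / 4) (by linarith)).and
    (rate hg (ε := -η / 4) (by linarith))).and (eventually_ge_atTop 1)).exists
  have h4 := hpos n h3
  rw [integral_add (hfi hf n) (hfi hg n)] at h4
  have h5 : (1 : ℝ) ≤ n := by exact_mod_cast h3
  nlinarith

end KrylovBogoliubov

/-! ### Continuity of extremal ratios of seminorms -/

section Ratio

variable {γ : Type*} [TopologicalSpace γ] {k : ℕ} {a b : γ → (Fin k → ℝ) → ℝ}

theorem continuous_ratio_sphere (ha : Continuous fun p : γ × (Fin k → ℝ) => a p.1 p.2)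
    (hb : Continuous fun p : γ × (Fin k → ℝ) => b p.1 p.2)
    (hpos : ∀ p c, c ≠ 0 → 0 < b p c) :
    Continuous ↿fun (p : γ) (c : Metric.sphere (0 : Fin k → ℝ) 1) => a p c / b p c := by
  have hi : Continuous fun p : γ × Metric.sphere (0 : Fin k → ℝ) 1 => (p.1, (p.2 : Fin k → ℝ)) := by
    fun_prop
  refine (ha.comp hi).div (hb.comp hi) fun p => ?_
  exact (hpos _ _ (ne_zero_of_mem_unit_sphere p.2)).ne'

theorem exists_sphere_smul (c : Fin k → ℝ) (hc : c ≠ 0) :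
    ∃ (r : ℝ) (d : Metric.sphere (0 : Fin k → ℝ) 1), c = r • (d : Fin k → ℝ) :=
  ⟨‖c‖, ⟨‖c‖⁻¹ • c, by simp [norm_smul, hc]⟩, by simp [smul_smul, hc]⟩

/-- By homogeneity `N p` is the maximum of `a p / b p` over the unit sphere of the fixed space `Fin
k → ℝ`, and a maximum over a compact set depends continuously on the parameter. In a local frame
this handles operator norms on varying fibres. -/
theorem continuous_of_least_ratio_bound (hk : 0 < k)
    (ha : Continuous fun p : γ × (Fin k → ℝ) => a p.1 p.2)
    (hb : Continuous fun p : γ × (Fin k → ℝ) => b p.1 p.2)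
    (ha_smul : ∀ p r c, a p (r • c) = |r| * a p c) (hb_smul : ∀ p r c, b p (r • c) = |r| * b p c)
    (ha_nonneg : ∀ p c, 0 ≤ a p c) (hpos : ∀ p c, c ≠ 0 → 0 < b p c) {N : γ → ℝ}
    (hN : ∀ p c, a p c ≤ N p * b p c)
    (hN' : ∀ p C, 0 ≤ C → (∀ c, a p c ≤ C * b p c) → N p ≤ C) : Continuous N := by
  have : Nonempty (Fin k) := ⟨⟨0, hk⟩⟩
  have hq := continuous_ratio_sphere ha hb hpos
  obtain ⟨d₀⟩ : Nonempty (Metric.sphere (0 : Fin k → ℝ) 1) :=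
    (NormedSpace.sphere_nonempty.2 zero_le_one).to_subtype
  convert! isCompact_univ.continuous_sSup hq using 1
  ext p
  set q : Metric.sphere (0 : Fin k → ℝ) 1 → ℝ := fun c => a p c / b p c with hqdef
  have hqc : Continuous q := hq.comp (Continuous.prodMk_right p)
  have hle : ∀ d, q d ≤ sSup (q '' univ) := fun d =>
    le_csSup (isCompact_univ.bddAbove_image hqc.continuousOn) (mem_image_of_mem _ (mem_univ d))
  have hbp : ∀ d : Metric.sphere (0 : Fin k → ℝ) 1, 0 < b p d := fun d =>
    hpos _ _ (ne_zero_of_mem_unit_sphere d)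
  refine le_antisymm (hN' p _ ((div_nonneg (ha_nonneg p _) (hbp d₀).le).trans (hle d₀))
    fun c => ?_) (csSup_le ((image_nonempty).2 ⟨d₀, mem_univ _⟩) ?_)
  · by_cases hc : c = 0
    · have h1 := ha_smul p 0 0
      have h2 := hb_smul p 0 0
      simp only [smul_zero, abs_zero, zero_mul] at h1 h2
      rw [hc, h1, h2, mul_zero]
    · obtain ⟨r, d, rfl⟩ := exists_sphere_smul c hc
      rw [ha_smul, hb_smul, mul_left_comm]
      exact mul_le_mul_of_nonneg_left ((div_le_iff₀ (hbp d)).1 (hle d)) (abs_nonneg r)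
  · rintro _ ⟨d, -, rfl⟩
    exact (div_le_iff₀ (hbp d)).2 (hN p d)

theorem continuous_of_greatest_ratio_bound (hk : 0 < k)
    (ha : Continuous fun p : γ × (Fin k → ℝ) => a p.1 p.2)
    (hb : Continuous fun p : γ × (Fin k → ℝ) => b p.1 p.2)
    (ha_smul : ∀ p r c, a p (r • c) = |r| * a p c) (hb_smul : ∀ p r c, b p (r • c) = |r| * b p c)
    (hpos : ∀ p c, c ≠ 0 → 0 < b p c) {N : γ → ℝ}
    (hN : ∀ p c, N p * b p c ≤ a p c)
    (hN' : ∀ p C, (∀ c, C * b p c ≤ a p c) → C ≤ N p) : Continuous N := by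
  have : Nonempty (Fin k) := ⟨⟨0, hk⟩⟩
  have hq := continuous_ratio_sphere ha hb hpos
  obtain ⟨d₀⟩ : Nonempty (Metric.sphere (0 : Fin k → ℝ) 1) :=
    (NormedSpace.sphere_nonempty.2 zero_le_one).to_subtype
  convert! isCompact_univ.continuous_sInf hq using 1
  ext p
  set q : Metric.sphere (0 : Fin k → ℝ) 1 → ℝ := fun c => a p c / b p c with hqdef
  have hqc : Continuous q := hq.comp (Continuous.prodMk_right p)
  have hle : ∀ d, sInf (q '' univ) ≤ q d := fun d =>
    csInf_le (isCompact_univ.bddBelow_image hqc.continuousOn) (mem_image_of_mem _ (mem_univ d))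
  have hbp : ∀ d : Metric.sphere (0 : Fin k → ℝ) 1, 0 < b p d := fun d =>
    hpos _ _ (ne_zero_of_mem_unit_sphere d)
  refine le_antisymm (le_csInf ((image_nonempty).2 ⟨d₀, mem_univ _⟩) ?_) (hN' p _ fun c => ?_)
  · rintro _ ⟨d, -, rfl⟩
    exact (le_div_iff₀ (hbp d)).2 (hN p d)
  · by_cases hc : c = 0
    · have h1 := ha_smul p 0 0
      have h2 := hb_smul p 0 0
      simp only [smul_zero, abs_zero, zero_mul] at h1 h2
      rw [hc, h1, h2, mul_zero]
    · obtain ⟨r, d, rfl⟩ := exists_sphere_smul c hc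
      rw [ha_smul, hb_smul, mul_left_comm]
      exact mul_le_mul_of_nonneg_left ((le_div_iff₀ (hbp d)).1 (hle d)) (abs_nonneg r)

/-- Reduces continuity of norms in a moving frame to continuity of the Gram matrix. -/
theorem norm_sum_smul_eq_sqrt {G : Type*} [NormedAddCommGroup G] [InnerProductSpace ℝ G]
    (c : Fin k → ℝ) (w : Fin k → G) :
    ‖∑ i, c i • w i‖ = √(∑ i, ∑ j, c i * c j * inner ℝ (w i) (w j)) := by
  rw [norm_eq_sqrt_real_inner, sum_inner]
  simp_rw [inner_sum, real_inner_smul_left, real_inner_smul_right, mul_assoc]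

end Ratio

/-! ### The derivative cocycle of a flow -/

section Derivative

variable {n : ℕ} {H : Type*} [TopologicalSpace H]
  {I : ModelWithCorners ℝ (EuclideanSpace ℝ (Fin n)) H}
  {M : Type*} [TopologicalSpace M] [ChartedSpace H M]
  {X : ∀ x : M, TangentSpace I x} {φ : ℝ → M → M}

theorem IsC1Flow.contMDiffOn_Ici (hφ : IsC1Flow X φ) :
    ContMDiffOn (𝓘(ℝ, ℝ).prod I) I 1 (fun p : ℝ × M => φ p.1 p.2) (Ici 0 ×ˢ univ) :=
  hφ.contMDiffOn.mono fun _ hp => Or.inl hp.1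

theorem IsC1Flow.contMDiff (hφ : IsC1Flow X φ) {t : ℝ} (ht : 0 ≤ t) : ContMDiff I I 1 (φ t) := by
  rw [← contMDiffOn_univ]
  exact hφ.contMDiffOn_Ici.comp (t := Ici 0 ×ˢ univ) (f := fun x : M => (t, x))
    (contMDiff_const.prodMk contMDiff_id).contMDiffOn
    fun x _ => ⟨ht, mem_univ _⟩

theorem IsC1Flow.mdifferentiableAt (hφ : IsC1Flow X φ) {t : ℝ} (ht : 0 ≤ t) (x : M) :
    MDifferentiableAt I I (φ t) x :=
  (hφ.contMDiff ht).mdifferentiable one_ne_zero x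

/-- Expresses `DX_t` through the derivative of the joint map in the direction `(0, v)`, so that
joint `C^1` regularity yields continuity of `DX_t` in `t` and `x` together. -/
theorem IsC1Flow.mfderivWithin_zero_apply (hφ : IsC1Flow X φ) {t : ℝ} (ht : 0 ≤ t) (x : M)
    (v : TangentSpace I x) :
    mfderivWithin (𝓘(ℝ, ℝ).prod I) I (fun p : ℝ × M => φ p.1 p.2) (Ici 0 ×ˢ univ) (t, x)
      ((0 : ℝ), v) = mfderiv I I (φ t) x v := by
  have h1 : MDifferentiableWithinAt (𝓘(ℝ, ℝ).prod I) I (fun p : ℝ × M => φ p.1 p.2)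
      (Ici 0 ×ˢ univ) (t, x) :=
    (hφ.contMDiffOn_Ici (t, x) ⟨ht, mem_univ _⟩).mdifferentiableWithinAt one_ne_zero
  have h2 : MDifferentiableAt I (𝓘(ℝ, ℝ).prod I) (fun x : M => (t, x)) x :=
    mdifferentiableAt_const.prodMk mdifferentiableAt_id
  have h3 := mfderivWithin_comp (s := univ) x h1 h2.mdifferentiableWithinAt
    (fun y _ => ⟨ht, mem_univ _⟩) (uniqueMDiffWithinAt_univ I)
  rw [mfderivWithin_univ, mfderivWithin_univ, mfderiv_prod_right] at h3
  exact (DFunLike.congr_fun h3 v).symm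

theorem IsC1Flow.continuousOn_mfderiv_section [IsManifold I ∞ M] (hφ : IsC1Flow X φ) {S : Set M}
    {s : ∀ x : M, TangentSpace I x}
    (hs : ContinuousOn (fun x => (⟨x, s x⟩ : TangentBundle I M)) S) :
    ContinuousOn (fun p : ℝ × M =>
      (⟨φ p.1 p.2, mfderiv I I (φ p.1) p.2 (s p.2)⟩ : TangentBundle I M)) (Ici 0 ×ˢ S) := by
  have huniq : UniqueMDiffOn (𝓘(ℝ, ℝ).prod I) (Ici (0 : ℝ) ×ˢ (univ : Set M)) :=
    (uniqueDiffOn_Ici (0 : ℝ)).uniqueMDiffOn.prod uniqueMDiffOn_univ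
  have h1 := hφ.contMDiffOn_Ici.continuousOn_tangentMapWithin le_rfl huniq
  have h2 : Continuous (equivTangentBundleProd 𝓘(ℝ, ℝ) ℝ I M).symm :=
    (contMDiff_equivTangentBundleProd_symm (n := 0)).continuous
  have h3 : ContinuousOn (fun p : ℝ × M => (equivTangentBundleProd 𝓘(ℝ, ℝ) ℝ I M).symm
      ((⟨p.1, (0 : ℝ)⟩ : TangentBundle 𝓘(ℝ, ℝ) ℝ), (⟨p.2, s p.2⟩ : TangentBundle I M)))
      (Ici 0 ×ˢ S) := by
    refine h2.comp_continuousOn (ContinuousOn.prodMk ?_ (hs.comp continuousOn_snd fun p hp => hp.2))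
    exact ((contMDiff_zeroSection (IB := 𝓘(ℝ, ℝ)) (F := ℝ) (n := 0) ℝ
      (TangentSpace 𝓘(ℝ, ℝ) : ℝ → Type _)).continuous.comp continuous_fst).continuousOn
  refine (h1.comp h3 fun p hp => ⟨hp.1, mem_univ _⟩).congr fun p hp => ?_
  simp only [Function.comp]
  rw [tangentMapWithin]
  congr 1
  exact (hφ.mfderivWithin_zero_apply hp.1 p.2 (s p.2)).symm

end Derivative

/-! ### Norm and conorm of the derivative restricted to a subbundle -/

section Restrict

variable {n : ℕ} {H : Type*} [TopologicalSpace H]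
  {I : ModelWithCorners ℝ (EuclideanSpace ℝ (Fin n)) H}
  {M : Type*} [TopologicalSpace M] [ChartedSpace H M]
  {X : ∀ x : M, TangentSpace I x} {φ : ℝ → M → M}

theorem IsInvariantSubbundle.mfderiv_mem {Λ : Set M} {V : ∀ x : M, Submodule ℝ (TangentSpace I x)}
    (hV : IsInvariantSubbundle φ Λ V) {x : M} (hx : x ∈ Λ)
    (t : ℝ) {v : TangentSpace I x} (hv : v ∈ V x) : mfderiv I I (φ t) x v ∈ V (φ t x) := by
  rw [← hV x hx t]
  exact ⟨v, hv, rfl⟩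

variable [RiemannianBundle (fun x : M => TangentSpace I x)]

theorem norm_mfderiv_le_normRestrict (t : ℝ) {x : M} {V : Submodule ℝ (TangentSpace I x)}
    {v : TangentSpace I x} (hv : v ∈ V) :
    ‖mfderiv I I (φ t) x v‖ ≤ normRestrict φ t x V * ‖v‖ :=
  ((mfderiv I I (φ t) x).comp V.subtypeL).le_opNorm ⟨v, hv⟩

theorem normRestrict_le {t : ℝ} {x : M} {V : Submodule ℝ (TangentSpace I x)} {C : ℝ} (hC : 0 ≤ C)
    (h : ∀ v ∈ V, ‖mfderiv I I (φ t) x v‖ ≤ C * ‖v‖) : normRestrict φ t x V ≤ C :=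
  ContinuousLinearMap.opNorm_le_bound _ hC fun v => h v v.2

theorem normRestrict_nonneg (t : ℝ) (x : M) (V : Submodule ℝ (TangentSpace I x)) :
    0 ≤ normRestrict φ t x V :=
  norm_nonneg ((mfderiv I I (φ t) x).comp V.subtypeL)

theorem conormRestrict_nonneg (t : ℝ) (x : M) (V : Submodule ℝ (TangentSpace I x)) :
    0 ≤ conormRestrict φ t x V := Real.iInf_nonneg fun _ => norm_nonneg _

theorem conormRestrict_mul_norm_le (t : ℝ) {x : M} {V : Submodule ℝ (TangentSpace I x)}
    {v : TangentSpace I x} (hv : v ∈ V) :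
    conormRestrict φ t x V * ‖v‖ ≤ ‖mfderiv I I (φ t) x v‖ := by
  by_cases h0 : v = 0
  · rw [h0, norm_zero, mul_zero]; exact norm_nonneg _
  have hn : 0 < ‖v‖ := norm_pos_iff.2 h0
  have h1 : ‖(⟨‖v‖⁻¹ • v, V.smul_mem _ hv⟩ : V)‖ = 1 := by
    rw [Submodule.coe_norm, norm_smul, norm_inv, norm_norm, inv_mul_cancel₀ hn.ne']
  have h2 : conormRestrict φ t x V ≤ ‖mfderiv I I (φ t) x (‖v‖⁻¹ • v)‖ :=
    ciInf_le (⟨0, by rintro _ ⟨v, rfl⟩; exact norm_nonneg _⟩ :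
      BddBelow (range fun v : {v : V // ‖v‖ = 1} => ‖mfderiv I I (φ t) x (v : V)‖)) ⟨_, h1⟩
  rw [map_smul, norm_smul, norm_inv, norm_norm, ← div_eq_inv_mul, le_div_iff₀ hn] at h2
  exact h2

theorem le_conormRestrict {t : ℝ} {x : M} {V : Submodule ℝ (TangentSpace I x)} (hV : V ≠ ⊥)
    {C : ℝ} (h : ∀ v ∈ V, C * ‖v‖ ≤ ‖mfderiv I I (φ t) x v‖) : C ≤ conormRestrict φ t x V := by
  obtain ⟨v, hv, h0⟩ := V.ne_bot_iff.1 hV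
  have hn : 0 < ‖v‖ := norm_pos_iff.2 h0
  have h1 : ‖(⟨‖v‖⁻¹ • v, V.smul_mem _ hv⟩ : V)‖ = 1 := by
    rw [Submodule.coe_norm, norm_smul, norm_inv, norm_norm, inv_mul_cancel₀ hn.ne']
  have : Nonempty {v : V // ‖v‖ = 1} := ⟨⟨_, h1⟩⟩
  refine le_ciInf fun w => ?_
  have h2 := h w.1 w.1.2
  have h3 : ‖(w.1 : TangentSpace I x)‖ = 1 := w.2
  rwa [h3, mul_one] at h2

theorem IsC1Flow.norm_mfderiv_add (hφ : IsC1Flow X φ) {s t : ℝ} (hs : 0 ≤ s) (ht : 0 ≤ t) (x : M)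
    (v : TangentSpace I x) :
    ‖mfderiv I I (φ (s + t)) x v‖ = ‖mfderiv I I (φ s) (φ t x) (mfderiv I I (φ t) x v)‖ := by
  have h : φ (s + t) = φ s ∘ φ t := funext fun x => hφ.map_add s t hs ht x
  rw [h, mfderiv_comp x (hφ.mdifferentiableAt hs _) (hφ.mdifferentiableAt ht x)]
  rfl

section Splitting

variable {Λ : Set M} {V : ∀ x : M, Submodule ℝ (TangentSpace I x)}

theorem normRestrict_add_le (hφ : IsC1Flow X φ) (hV : IsInvariantSubbundle φ Λ V) {s t : ℝ}
    (hs : 0 ≤ s) (ht : 0 ≤ t) {x : M} (hx : x ∈ Λ) :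
    normRestrict φ (s + t) x (V x) ≤
      normRestrict φ s (φ t x) (V (φ t x)) * normRestrict φ t x (V x) := by
  refine normRestrict_le (mul_nonneg (normRestrict_nonneg _ _ _) (normRestrict_nonneg _ _ _))
    fun v hv => ?_
  rw [hφ.norm_mfderiv_add hs ht, mul_assoc]
  exact (norm_mfderiv_le_normRestrict s (hV.mfderiv_mem hx t hv)).trans
    (mul_le_mul_of_nonneg_left (norm_mfderiv_le_normRestrict t hv) (normRestrict_nonneg _ _ _))

theorem conormRestrict_mul_le_add (hφ : IsC1Flow X φ) (hV : IsInvariantSubbundle φ Λ V) {s t : ℝ}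
    (hs : 0 ≤ s) (ht : 0 ≤ t) {x : M} (hx : x ∈ Λ) (h0 : V x ≠ ⊥) :
    conormRestrict φ s (φ t x) (V (φ t x)) * conormRestrict φ t x (V x) ≤
      conormRestrict φ (s + t) x (V x) := by
  refine le_conormRestrict h0 fun v hv => ?_
  rw [hφ.norm_mfderiv_add hs ht, mul_assoc]
  exact (mul_le_mul_of_nonneg_left (conormRestrict_mul_norm_le t hv)
    (conormRestrict_nonneg _ _ _)).trans (conormRestrict_mul_norm_le s (hV.mfderiv_mem hx t hv))

/-- Every vector of the fibre at `φ s x` is `DX_s v` with `v ∈ V x`, and `‖v‖` is at most its norm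
divided by the conorm. This is the source of `le_shift` for the norm cocycle;
`conormRestrict_add_le` is its counterpart for the conorm. -/
theorem normRestrict_mul_conormRestrict_le (hφ : IsC1Flow X φ) (hV : IsInvariantSubbundle φ Λ V)
    {s t : ℝ} (hs : 0 ≤ s) (ht : 0 ≤ t) {x : M} (hx : x ∈ Λ)
    (hpos : 0 < conormRestrict φ s x (V x)) :
    normRestrict φ t (φ s x) (V (φ s x)) * conormRestrict φ s x (V x) ≤
      normRestrict φ (t + s) x (V x) := by
  rw [← le_div_iff₀ hpos]
  refine normRestrict_le (div_nonneg (normRestrict_nonneg _ _ _) hpos.le) fun u hu => ?_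
  rw [← hV x hx s] at hu
  obtain ⟨v, hv, rfl⟩ := hu
  have h1 := norm_mfderiv_le_normRestrict (φ := φ) (t + s) hv
  rw [hφ.norm_mfderiv_add ht hs] at h1
  refine h1.trans ?_
  rw [div_mul_eq_mul_div, mul_div_assoc]
  refine mul_le_mul_of_nonneg_left ?_ (normRestrict_nonneg _ _ _)
  rw [le_div_iff₀ hpos, mul_comm]
  exact conormRestrict_mul_norm_le s hv

theorem conormRestrict_add_le (hφ : IsC1Flow X φ) (hV : IsInvariantSubbundle φ Λ V)
    {s t : ℝ} (hs : 0 ≤ s) (ht : 0 ≤ t) {x : M} (hx : x ∈ Λ) (h0 : V (φ s x) ≠ ⊥)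
    (hpos : 0 < normRestrict φ s x (V x)) :
    conormRestrict φ (t + s) x (V x) ≤
      conormRestrict φ t (φ s x) (V (φ s x)) * normRestrict φ s x (V x) := by
  rw [← div_le_iff₀ hpos]
  refine le_conormRestrict h0 fun u hu => ?_
  rw [← hV x hx s] at hu
  obtain ⟨v, hv, rfl⟩ := hu
  have h1 := conormRestrict_mul_norm_le (φ := φ) (t + s) hv
  rw [hφ.norm_mfderiv_add ht hs] at h1
  refine le_trans ?_ h1
  rw [div_mul_eq_mul_div, mul_div_assoc]
  refine mul_le_mul_of_nonneg_left ?_ (conormRestrict_nonneg _ _ _)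
  rw [div_le_iff₀ hpos, mul_comm]
  exact norm_mfderiv_le_normRestrict s hv

end Splitting

/-- A subbundle has continuous norm and conorm of the restricted derivative of the flow. -/
theorem IsContinuousSubbundle.exists_continuousOn [IsManifold I ∞ M] [IsContMDiffRiemannianBundle I ∞
      (EuclideanSpace ℝ (Fin n)) (fun x : M => TangentSpace I x)]
    (hφ : IsC1Flow X φ) {Λ : Set M} {V : ∀ x : M, Submodule ℝ (TangentSpace I x)}
    (hV : IsContinuousSubbundle Λ V) (hne : ∀ x ∈ Λ, V x ≠ ⊥) {x₀ : M} (hx₀ : x₀ ∈ Λ) :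
    ∃ U : Set M, IsOpen U ∧ x₀ ∈ U ∧
      ContinuousOn (fun p : ℝ × M => normRestrict φ p.1 p.2 (V p.2)) (Ici 0 ×ˢ (U ∩ Λ)) ∧
      ContinuousOn (fun p : ℝ × M => conormRestrict φ p.1 p.2 (V p.2)) (Ici 0 ×ˢ (U ∩ Λ)) := by
  obtain ⟨U, hU, hxU, k, s, hs, hspan⟩ := hV x₀ hx₀
  refine ⟨U, hU, hxU, ?_⟩
  have hk : 0 < k := by
    rcases Nat.eq_zero_or_pos k with rfl | h
    · exact absurd (by rw [← (hspan x₀ ⟨hxU, hx₀⟩).2]; simp) (hne x₀ hx₀)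
    · exact h
  set S : Set (ℝ × M) := Ici 0 ×ˢ (U ∩ Λ) with hS
  have : IsContinuousRiemannianBundle (EuclideanSpace ℝ (Fin n))
    (fun x : M => TangentSpace I x) := by
    obtain ⟨g, hg, hg'⟩ := IsContMDiffRiemannianBundle.exists_contMDiff (IB := I) (n := ∞)
      (F := EuclideanSpace ℝ (Fin n)) (E := fun x : M => TangentSpace I x)
    exact ⟨g, hg.continuous, hg'⟩
  have hGa : ∀ i j, ContinuousOn (fun p : ℝ × M => inner ℝ (mfderiv I I (φ p.1) p.2 (s i p.2))
      (mfderiv I I (φ p.1) p.2 (s j p.2))) S := fun i j =>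
    (hφ.continuousOn_mfderiv_section (hs i)).inner_bundle
      (hφ.continuousOn_mfderiv_section (hs j))
  have hGb : ∀ i j, ContinuousOn (fun p : ℝ × M => inner ℝ (s i p.2) (s j p.2)) S := fun i j =>
    ((hs i).inner_bundle (hs j)).comp continuousOn_snd fun p hp => hp.2
  set a : S → (Fin k → ℝ) → ℝ := fun p c =>
    ‖mfderiv I I (φ p.1.1) p.1.2 (∑ i, c i • s i p.1.2)‖ with ha
  set b : S → (Fin k → ℝ) → ℝ := fun p c => ‖∑ i, c i • s i p.1.2‖ with hb
  have hac : Continuous fun p : S × (Fin k → ℝ) => a p.1 p.2 := by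
    simp only [ha, map_sum, map_smul, norm_sum_smul_eq_sqrt]
    refine Real.continuous_sqrt.comp (continuous_finsetSum _ fun i _ =>
      continuous_finsetSum _ fun j _ => ?_)
    exact (by fun_prop : Continuous fun p : S × (Fin k → ℝ) => p.2 i * p.2 j).mul
      ((continuousOn_iff_continuous_domRestrict.1 (hGa i j)).comp continuous_fst)
  have hbc : Continuous fun p : S × (Fin k → ℝ) => b p.1 p.2 := by
    simp only [hb, norm_sum_smul_eq_sqrt]
    refine Real.continuous_sqrt.comp (continuous_finsetSum _ fun i _ =>
      continuous_finsetSum _ fun j _ => ?_)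
    exact (by fun_prop : Continuous fun p : S × (Fin k → ℝ) => p.2 i * p.2 j).mul
      ((continuousOn_iff_continuous_domRestrict.1 (hGb i j)).comp continuous_fst)
  have hsmul : ∀ (p : S) (r : ℝ) (c : Fin k → ℝ),
      ∑ i, (r • c) i • s i p.1.2 = r • ∑ i, c i • s i p.1.2 := by
    intro p r c
    simp [Finset.smul_sum, smul_smul]
  have hasmul : ∀ p r c, a p (r • c) = |r| * a p c := by
    intro p r c
    simp only [ha]
    rw [hsmul, map_smul, norm_smul, Real.norm_eq_abs]
  have hbsmul : ∀ p r c, b p (r • c) = |r| * b p c := by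
    intro p r c
    simp only [hb]
    rw [hsmul, norm_smul, Real.norm_eq_abs]
  have hbpos : ∀ p c, c ≠ 0 → 0 < b p c := by
    intro p c hc
    refine norm_pos_iff.2 fun h0 => hc (funext fun i => ?_)
    exact Fintype.linearIndependent_iff.1 (hspan p.1.2 p.2.2).1 c h0 i
  have hmem : ∀ (p : S) (c : Fin k → ℝ), ∑ i, c i • s i p.1.2 ∈ V p.1.2 := by
    intro p c
    rw [← (hspan p.1.2 p.2.2).2]
    exact Submodule.sum_mem _ fun i _ => Submodule.smul_mem _ _ (Submodule.subset_span ⟨i, rfl⟩)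
  have hsurj : ∀ (p : S), ∀ v ∈ V p.1.2, ∃ c : Fin k → ℝ, ∑ i, c i • s i p.1.2 = v := by
    intro p v hv
    rw [← (hspan p.1.2 p.2.2).2] at hv
    exact Submodule.mem_span_range_iff_exists_fun ℝ |>.1 hv
  constructor <;> rw [continuousOn_iff_continuous_domRestrict]
  · refine continuous_of_least_ratio_bound hk hac hbc hasmul hbsmul (fun p c => norm_nonneg _)
      hbpos (fun p c => norm_mfderiv_le_normRestrict _ (hmem p c)) fun p C hC h =>
        normRestrict_le hC fun v hv => ?_
    obtain ⟨c, rfl⟩ := hsurj p v hv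
    exact h c
  · refine continuous_of_greatest_ratio_bound hk hac hbc hasmul hbsmul
      hbpos (fun p c => conormRestrict_mul_norm_le _ (hmem p c)) fun p C h =>
        le_conormRestrict (hne _ p.2.2.2) fun v hv => ?_
    obtain ⟨c, rfl⟩ := hsurj p v hv
    exact h c

end Restrict

/-! ### Growth rates in real and in integer time -/

/-- No boundedness is needed: on `ℝ`, `sInf S` is by definition `-sSup (-S)`. -/
theorem limsup_eq_neg_liminf_neg {ι : Type*} (l : Filter ι) (u : ι → ℝ) :
    limsup u l = -liminf (fun i => -u i) l := by
  rw [limsup_eq, liminf_eq, Real.sInf_def]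
  congr 2
  ext a
  simp [le_neg]

theorem liminf_add_liminf_le {ι : Type*} {l : Filter ι} [l.NeBot] {u v : ι → ℝ} {a c : ℝ}
    (hu : ∀ᶠ i in l, |u i| ≤ a) (hv : ∀ᶠ i in l, |v i| ≤ a)
    (h : ∀ ε > 0, ∀ᶠ i in l, u i + v i ≤ c + ε) : liminf u l + liminf v l ≤ c := by
  have hub : IsBoundedUnder (· ≥ ·) l u :=
    isBoundedUnder_of_eventually_ge (a := -a) (hu.mono fun i hi => (abs_le.1 hi).1)
  have hvb : IsBoundedUnder (· ≥ ·) l v :=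
    isBoundedUnder_of_eventually_ge (a := -a) (hv.mono fun i hi => (abs_le.1 hi).1)
  refine le_of_forall_pos_le_add fun ε hε => ?_
  have h1 := eventually_lt_of_lt_liminf (b := liminf u l - ε / 3) (by linarith) hub
  have h2 := eventually_lt_of_lt_liminf (b := liminf v l - ε / 3) (by linarith) hvb
  obtain ⟨i, hi1, hi2, hi3⟩ := (h1.and (h2.and (h (ε / 3) (by linarith)))).exists
  linarith

section Rate

variable {Y : Type*} [TopologicalSpace Y] [CompactSpace Y] {ψ : ℝ → Y → Y} {f : ℝ → Y → ℝ}

theorem IsSubadditiveCocycle.exists_eventually_abs_le (hf : IsSubadditiveCocycle ψ f) :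
    ∃ D, ∀ x, ∀ᶠ t : ℝ in atTop, |1 / t * f t x| ≤ D := by
  obtain ⟨D, hD0, hD⟩ := hf.exists_linear_bound
  refine ⟨2 * D, fun x => ?_⟩
  filter_upwards [eventually_ge_atTop 1] with t ht
  have ht0 : 0 < t := by linarith
  rw [one_div_mul_eq_div, abs_div, abs_of_pos ht0, div_le_iff₀ ht0]
  nlinarith [hD t ht0.le x]

/-- Compare time `t` with `⌈t⌉`: subadditivity gives `f ⌈t⌉ ≤ f t + 2 D`, and changing the
denominator costs a further `2 D / t` at most. This transfers the real-time hypothesis to integer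
times. -/
theorem IsSubadditiveCocycle.liminf_nat_le_liminf_real (hf : IsSubadditiveCocycle ψ f) (x : Y) :
    liminf (fun n : ℕ => f n x / n) atTop ≤ liminf (fun t : ℝ => 1 / t * f t x) atTop := by
  obtain ⟨D, hD0, hD⟩ := hf.exists_linear_bound
  obtain ⟨D', hD'⟩ := hf.exists_eventually_abs_le
  have hb : ∀ n : ℕ, |f n x / n| ≤ 2 * D :=
    bounded_div_of_linear_bound fun n => hD n n.cast_nonneg x
  have h1 : liminf (fun n : ℕ => f n x / n) atTop ≤
      liminf (fun t : ℝ => f ⌈t⌉₊ x / ⌈t⌉₊) atTop := by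
    refine liminf_le_liminf_of_le (f := atTop) (g := map (fun t : ℝ => ⌈t⌉₊) atTop)
      (u := fun n : ℕ => f n x / n) tendsto_nat_ceil_atTop
      (isBoundedUnder_of ⟨-(2 * D), fun n => (abs_le.1 (hb n)).1⟩)
      (isBoundedUnder_of ⟨2 * D, fun n => (abs_le.1 (hb n)).2⟩).isCoboundedUnder_ge
  refine h1.trans (liminf_le_liminf_of_eventually_le_add (a := max (2 * D) D')
    (.of_forall fun t => (hb _).trans (le_max_left _ _))
    ((hD' x).mono fun t ht => ht.trans (le_max_right _ _)) fun ε hε => ?_)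
  filter_upwards [eventually_ge_atTop 1, eventually_ge_atTop (4 * D / ε)] with t ht ht'
  have ht0 : 0 < t := by linarith
  have hn1 : t ≤ ⌈t⌉₊ := Nat.le_ceil t
  have hn2 := (Nat.ceil_lt_add_one ht0.le).le
  have hε' : 4 * D / t ≤ ε := by
    rw [div_le_iff₀ ht0]; rw [div_le_iff₀ hε] at ht'; linarith
  set m : ℝ := ((⌈t⌉₊ : ℕ) : ℝ) with hm
  have h2 := hf.subadd (m - t) t (by linarith) ht0.le x
  rw [sub_add_cancel] at h2
  have h3 := (abs_le.1 (hD (m - t) (by linarith) (ψ t x))).2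
  have h4 := (abs_le.1 (hD t ht0.le x)).1
  have h5 : f m x ≤ f t x + 2 * D := by nlinarith
  have h6 : f m x / m ≤ 1 / t * f t x + 4 * D / t := by
    rw [one_div_mul_eq_div, ← add_div, div_le_div_iff₀ (by linarith) ht0]
    have h7 : D * (t + 1) * (m - t) ≤ D * (t + 1) * 1 := by gcongr; linarith
    have h8 : D * t ≤ D * m := by gcongr
    have h9 : D * 1 ≤ D * t := by gcongr
    have h10 := mul_le_mul_of_nonneg_right h5 ht0.le
    have h11 := mul_le_mul_of_nonneg_left h4 (sub_nonneg.2 hn1)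
    linarith
  linarith

end Rate

theorem exists_pos_mul_norm_le_of_surjective {G G' : Type*} [NormedAddCommGroup G]
    [NormedSpace ℝ G] [NormedAddCommGroup G'] [NormedSpace ℝ G'] [FiniteDimensional ℝ G]
    [FiniteDimensional ℝ G'] (hG : Module.finrank ℝ G = Module.finrank ℝ G') (A : G →L[ℝ] G')
    (hA : Function.Surjective A) : ∃ c > 0, ∀ v, c * ‖v‖ ≤ ‖A v‖ := by
  have hA : Function.Injective A.toLinearMap :=
    (LinearMap.injective_iff_surjective_of_finrank_eq_finrank hG).2 hA
  obtain ⟨K, hK, h⟩ := A.toLinearMap.exists_antilipschitzWith (LinearMap.ker_eq_bot.2 hA)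
  refine ⟨(K : ℝ)⁻¹, inv_pos.2 hK, fun v => ?_⟩
  have h1 := h.le_mul_dist v 0
  rw [map_zero, dist_zero_right, dist_zero_right] at h1
  rwa [inv_mul_le_iff₀ (by exact_mod_cast hK)]

/-! ### The two cocycles of an invariant splitting -/

section Splitting

variable {n : ℕ} {H : Type*} [TopologicalSpace H]
  {I : ModelWithCorners ℝ (EuclideanSpace ℝ (Fin n)) H}
  {M : Type*} [TopologicalSpace M] [ChartedSpace H M]
  {X : ∀ x : M, TangentSpace I x} {φ : ℝ → M → M} {Λ : Set M}
  {E F V : ∀ x : M, Submodule ℝ (TangentSpace I x)}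

theorem IsInvariantSet.mapsTo {M : Type*} {φ : ℝ → M → M} {Λ : Set M} (hΛ : IsInvariantSet φ Λ) (t : ℝ) : MapsTo (φ t) Λ Λ :=
  fun _ hx => (hΛ t).subset (mem_image_of_mem _ hx)

/-- The restriction of the flow to an invariant set. -/
def IsInvariantSet.restrict {M : Type*} {φ : ℝ → M → M} {Λ : Set M} (hΛ : IsInvariantSet φ Λ) (t : ℝ) : Λ → Λ := (hΛ.mapsTo t).restrict

theorem IsC1Flow.isSemiflow_restrict (hφ : IsC1Flow X φ) (hΛ : IsInvariantSet φ Λ) :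
    IsSemiflow hΛ.restrict where
  map_zero x := Subtype.ext (hφ.map_zero x)
  map_add s t hs ht x := Subtype.ext (hφ.map_add s t hs ht x)
  continuousOn := by
    refine Topology.IsInducing.subtypeVal.continuousOn_iff.2 ?_
    exact hφ.contMDiffOn_Ici.continuousOn.comp (f := fun p : ℝ × Λ => (p.1, (p.2 : M)))
      (by fun_prop) fun p hp => ⟨hp.1, mem_univ _⟩

theorem IsContinuousInvariantSplitting.surjective_mfderiv [IsManifold I ∞ M]
    (hEF : IsContinuousInvariantSplitting φ Λ E F) (hΛ : IsInvariantSet φ Λ) {x : M} (hx : x ∈ Λ)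
    (t : ℝ) : Function.Surjective (mfderiv I I (φ t) x) := by
  have h1 : LinearMap.range (mfderiv I I (φ t) x).toLinearMap = ⊤ := by
    rw [← Submodule.map_top, ← (hEF.isCompl x hx).sup_eq_top, Submodule.map_sup,
      hEF.invariant_left x hx t, hEF.invariant_right x hx t,
      (hEF.isCompl _ (hΛ.mapsTo t hx)).sup_eq_top]
  exact LinearMap.range_eq_top.1 h1

/-- At a point of non-differentiability `mfderiv` is zero by convention, so invariance would force a
zero fibre. This covers negative `t`. -/
theorem IsInvariantSubbundle.mdifferentiableAt (hV : IsInvariantSubbundle φ Λ V)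
    (hΛ : IsInvariantSet φ Λ) (hne : ∀ x ∈ Λ, V x ≠ ⊥) {x : M} (hx : x ∈ Λ) (t : ℝ) :
    MDifferentiableAt I I (φ t) x := by
  by_contra h
  refine hne _ (hΛ.mapsTo t hx) ?_
  rw [← hV x hx t, mfderiv_zero_of_not_mdifferentiableAt h]
  exact Submodule.map_zero _

variable [RiemannianBundle (fun x : M => TangentSpace I x)]

theorem normRestrict_pos (hV : IsInvariantSubbundle φ Λ V)
    (hΛ : IsInvariantSet φ Λ) (hne : ∀ x ∈ Λ, V x ≠ ⊥) {x : M} (hx : x ∈ Λ) (t : ℝ) :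
    0 < normRestrict φ t x (V x) := by
  refine (normRestrict_nonneg t x _).lt_of_ne fun h => hne _ (hΛ.mapsTo t hx) ?_
  rw [← hV x hx t, Submodule.eq_bot_iff]
  rintro _ ⟨v, hv, rfl⟩
  have h1 := norm_mfderiv_le_normRestrict (φ := φ) t hv
  rw [← h, zero_mul] at h1
  exact norm_le_zero_iff.1 h1

theorem IsContinuousInvariantSplitting.conormRestrict_pos [IsManifold I ∞ M]
    (hEF : IsContinuousInvariantSplitting φ Λ E F) (hΛ : IsInvariantSet φ Λ) {x : M} (hx : x ∈ Λ)
    (t : ℝ) {W : Submodule ℝ (TangentSpace I x)} (hW : W ≠ ⊥) :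
    0 < conormRestrict φ t x W := by
  have : FiniteDimensional ℝ (TangentSpace I x) :=
    inferInstanceAs (FiniteDimensional ℝ (EuclideanSpace ℝ (Fin n)))
  have : FiniteDimensional ℝ (TangentSpace I (φ t x)) :=
    inferInstanceAs (FiniteDimensional ℝ (EuclideanSpace ℝ (Fin n)))
  obtain ⟨c, hc, h⟩ := exists_pos_mul_norm_le_of_surjective (G := TangentSpace I x)
    (G' := TangentSpace I (φ t x)) rfl (mfderiv I I (φ t) x)
    (hEF.surjective_mfderiv hΛ hx t)
  exact hc.trans_le (le_conormRestrict hW fun v _ => h v)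

theorem IsC1Flow.normRestrict_neg (hφ : IsC1Flow X φ) (hV : IsInvariantSubbundle φ Λ V)
    (hΛ : IsInvariantSet φ Λ) (hne : ∀ x ∈ Λ, V x ≠ ⊥) {x : M} (hx : x ∈ Λ) {t : ℝ} (ht : 0 ≤ t)
    (hpos : 0 < conormRestrict φ t x (V x)) :
    normRestrict φ (-t) (φ t x) (V (φ t x)) = (conormRestrict φ t x (V x))⁻¹ := by
  have hinv : ∀ v : TangentSpace I x,
      ‖mfderiv I I (φ (-t)) (φ t x) (mfderiv I I (φ t) x v)‖ = ‖v‖ := by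
    intro v
    have h1 : φ (-t) ∘ φ t = id := funext fun y => hφ.left_inv t ht y
    have h2 : ‖mfderiv I I (φ (-t) ∘ φ t) x v‖ = ‖v‖ := by
      rw [h1, mfderiv_id]; rfl
    rw [mfderiv_comp x (hV.mdifferentiableAt hΛ hne (hΛ.mapsTo t hx) (-t))
      (hφ.mdifferentiableAt ht x)] at h2
    exact h2
  have hpos' := normRestrict_pos hV hΛ hne (hΛ.mapsTo t hx) (-t)
  refine le_antisymm (normRestrict_le (inv_nonneg.2 hpos.le) fun u hu => ?_) ?_
  · rw [← hV x hx t] at hu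
    obtain ⟨v, hv, rfl⟩ := hu
    refine (hinv v).trans_le ?_
    rw [← div_eq_inv_mul, le_div_iff₀ hpos, mul_comm]
    exact conormRestrict_mul_norm_le t hv
  · rw [inv_le_comm₀ hpos hpos']
    refine le_conormRestrict (hne x hx) fun v hv => ?_
    rw [inv_mul_le_iff₀ hpos', ← hinv v]
    exact norm_mfderiv_le_normRestrict (-t) (hV.mfderiv_mem hx t hv)

variable [IsManifold I ∞ M] [IsContMDiffRiemannianBundle I ∞ (EuclideanSpace ℝ (Fin n))
  (fun x : M => TangentSpace I x)]

theorem IsContinuousSubbundle.continuousOn_restrict (hφ : IsC1Flow X φ)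
    (hV : IsContinuousSubbundle Λ V) (hne : ∀ x ∈ Λ, V x ≠ ⊥) :
    ContinuousOn (fun p : ℝ × Λ => normRestrict φ p.1 (p.2 : M) (V p.2)) (Ici 0 ×ˢ univ) ∧
      ContinuousOn (fun p : ℝ × Λ => conormRestrict φ p.1 (p.2 : M) (V p.2)) (Ici 0 ×ˢ univ) := by
  have key : ∀ u : ℝ × M → ℝ, (∀ x₀ ∈ Λ, ∃ U : Set M, IsOpen U ∧ x₀ ∈ U ∧
      ContinuousOn u (Ici 0 ×ˢ (U ∩ Λ))) →
      ContinuousOn (fun p : ℝ × Λ => u (p.1, p.2)) (Ici 0 ×ˢ univ) := by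
    intro u hu ⟨t, x⟩ ht
    obtain ⟨U, hU, hxU, hc⟩ := hu x x.2
    have h1 : ContinuousOn (fun p : ℝ × Λ => u (p.1, p.2)) (Ici 0 ×ˢ (Subtype.val ⁻¹' U)) :=
      hc.comp (f := fun p : ℝ × Λ => (p.1, (p.2 : M))) (by fun_prop)
        fun p hp => ⟨hp.1, hp.2, p.2.2⟩
    refine (h1 (t, x) ⟨ht.1, hxU⟩).mono_of_mem_nhdsWithin ?_
    rw [nhdsWithin_prod_eq]
    exact prod_mem_prod self_mem_nhdsWithin
      (mem_nhdsWithin_of_mem_nhds ((hU.preimage continuous_subtype_val).mem_nhds hxU))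
  constructor
  · refine key (fun p => normRestrict φ p.1 p.2 (V p.2)) fun x hx => ?_
    obtain ⟨U, h1, h2, h3, -⟩ := hV.exists_continuousOn hφ hne hx
    exact ⟨U, h1, h2, h3⟩
  · refine key (fun p => conormRestrict φ p.1 p.2 (V p.2)) fun x hx => ?_
    obtain ⟨U, h1, h2, -, h3⟩ := hV.exists_continuousOn hφ hne hx
    exact ⟨U, h1, h2, h3⟩

theorem exists_bound_of_continuousOn_Icc {Y : Type*} [TopologicalSpace Y] [CompactSpace Y]
    {u : ℝ × Y → ℝ} (hu : ContinuousOn u (Ici 0 ×ˢ univ)) :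
    ∃ C, ∀ s : ℝ, 0 ≤ s → s ≤ 1 → ∀ x, |u (s, x)| ≤ C := by
  obtain ⟨C, hC⟩ := (isCompact_Icc.prod isCompact_univ).exists_bound_of_continuousOn
    (hu.mono (prod_mono (Icc_subset_Ici_self : Icc (0 : ℝ) 1 ⊆ Ici 0) subset_rfl))
  exact ⟨C, fun s h0 h1 x => hC (s, x) ⟨⟨h0, h1⟩, mem_univ _⟩⟩

theorem isSubadditiveCocycle_log_normRestrict (hφ : IsC1Flow X φ) (hΛc : IsCompact Λ)
    (hΛ : IsInvariantSet φ Λ) (hVc : IsContinuousSubbundle Λ V) (hV : IsInvariantSubbundle φ Λ V)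
    (hne : ∀ x ∈ Λ, V x ≠ ⊥) (hpos : ∀ x ∈ Λ, ∀ t, 0 < conormRestrict φ t x (V x)) :
    IsSubadditiveCocycle hΛ.restrict fun t x => Real.log (normRestrict φ t (x : M) (V x)) := by
  have hpos' : ∀ x ∈ Λ, ∀ t, 0 < normRestrict φ t x (V x) := fun x hx t =>
    normRestrict_pos hV hΛ hne hx t
  have hc := hVc.continuousOn_restrict hφ hne
  have : CompactSpace Λ := isCompact_iff_compactSpace.1 hΛc
  refine ⟨hc.1.log fun p _ => (hpos' _ p.2.2 _).ne', fun s t hs ht x => ?_, ?_⟩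
  · rw [← Real.log_mul (hpos' _ (hΛ.restrict t x).2 _).ne' (hpos' _ x.2 _).ne']
    exact Real.log_le_log (hpos' _ x.2 _) (normRestrict_add_le hφ hV hs ht x.2)
  -- `C` bounds the logarithm of the conorm over `[0, 1] × Λ`, where it is continuous because the
  -- conorm is positive.
  · obtain ⟨C, hC⟩ := exists_bound_of_continuousOn_Icc
      (hc.2.log fun p _ => (hpos _ p.2.2 _).ne')
    refine ⟨C, fun s t hs hs1 ht x => ?_⟩
    have h1 := Real.log_le_log
      (mul_pos (hpos' _ (hΛ.restrict s x).2 t) (hpos x x.2 s))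
      (normRestrict_mul_conormRestrict_le hφ hV hs ht x.2 (hpos x x.2 s))
    rw [Real.log_mul (hpos' _ (hΛ.restrict s x).2 t).ne' (hpos x x.2 s).ne'] at h1
    have h2 := (abs_le.1 (hC s hs hs1 x)).1
    linarith

theorem isSubadditiveCocycle_neg_log_conormRestrict (hφ : IsC1Flow X φ) (hΛc : IsCompact Λ)
    (hΛ : IsInvariantSet φ Λ) (hVc : IsContinuousSubbundle Λ V) (hV : IsInvariantSubbundle φ Λ V)
    (hne : ∀ x ∈ Λ, V x ≠ ⊥) (hpos : ∀ x ∈ Λ, ∀ t, 0 < conormRestrict φ t x (V x)) :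
    IsSubadditiveCocycle hΛ.restrict fun t x => -Real.log (conormRestrict φ t (x : M) (V x)) := by
  have hpos' : ∀ x ∈ Λ, ∀ t, 0 < normRestrict φ t x (V x) := fun x hx t =>
    normRestrict_pos hV hΛ hne hx t
  have hc := hVc.continuousOn_restrict hφ hne
  have : CompactSpace Λ := isCompact_iff_compactSpace.1 hΛc
  refine ⟨(hc.2.log fun p _ => (hpos _ p.2.2 _).ne').neg, fun s t hs ht x => ?_, ?_⟩
  · rw [← neg_add, neg_le_neg_iff,
      ← Real.log_mul (hpos _ (hΛ.restrict t x).2 _).ne' (hpos _ x.2 _).ne']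
    exact Real.log_le_log (mul_pos (hpos _ (hΛ.restrict t x).2 _) (hpos _ x.2 _))
      (conormRestrict_mul_le_add hφ hV hs ht x.2 (hne x x.2))
  · obtain ⟨C, hC⟩ := exists_bound_of_continuousOn_Icc
      (hc.1.log fun p _ => (hpos' _ p.2.2 _).ne')
    refine ⟨C, fun s t hs hs1 ht x => ?_⟩
    have h1 := Real.log_le_log (hpos x x.2 (t + s))
      (conormRestrict_add_le hφ hV hs ht x.2 (hne _ (hΛ.restrict s x).2) (hpos' x x.2 s))
    rw [Real.log_mul (hpos _ (hΛ.mapsTo s x.2) t).ne' (hpos' x x.2 s).ne'] at h1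
    have h2 := (abs_le.1 (hC s hs hs1 x)).2
    change -Real.log (conormRestrict φ t (φ s x) (V (φ s x))) ≤ _
    linarith

end Splitting

/-! ### Invariant measures on an invariant set -/

theorem isInvariantProbability_map_val {n : ℕ} {H : Type*} [TopologicalSpace H]
    {I : ModelWithCorners ℝ (EuclideanSpace ℝ (Fin n)) H}
    {M : Type*} [TopologicalSpace M] [ChartedSpace H M] [T2Space M] [MeasurableSpace M]
    [BorelSpace M] {X : ∀ x : M, TangentSpace I x} {φ : ℝ → M → M} {Λ : Set M}
    (hφ : IsC1Flow X φ) (hΛc : IsCompact Λ) (hΛ : IsInvariantSet φ Λ) {μ : Measure Λ}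
    [IsProbabilityMeasure μ]
    (hμ : ∀ t : ℝ, 0 ≤ t → MeasurePreserving (hΛ.restrict t) μ μ) :
    IsInvariantProbability φ Λ (μ.map Subtype.val) := by
  have hemb : MeasurableEmbedding (Subtype.val : Λ → M) :=
    .subtype_coe hΛc.isClosed.measurableSet
  have : CompactSpace Λ := isCompact_iff_compactSpace.1 hΛc
  refine ⟨Measure.isProbabilityMeasure_map measurable_subtype_coe.aemeasurable, ?_,
    fun t A hA => ?_⟩
  · rw [hemb.map_apply]; simp
  · rw [hemb.map_apply, hemb.map_apply]
    change μ (hΛ.restrict t ⁻¹' (Subtype.val ⁻¹' A)) = _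
    rcases le_total 0 t with ht | ht
    · exact (hμ t ht).measure_preimage (measurable_subtype_coe hA).nullMeasurableSet
    · have ht' : 0 ≤ -t := by linarith
      -- For `t ≤ 0` the map `X_t` on `Λ` is a left inverse of `X_{-t}`, a continuous injection of a
      -- compact space. Taking the preimage under `X_{-t}` preserves the measure of every set, so
      -- measurability of `X_t` is not required.
      have hinv : Function.LeftInverse (hΛ.restrict t) (hΛ.restrict (-t)) := fun x =>
        Subtype.ext ((congrArg (φ · (φ (-t) x)) (neg_neg t)).symm.trans (hφ.left_inv (-t) ht' x))
      have hme : MeasurableEmbedding (hΛ.restrict (-t)) :=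
        (((hφ.isSemiflow_restrict hΛ).continuous ht').isClosedEmbedding
          hinv.injective).measurableEmbedding
      rw [← (hμ (-t) ht').measure_preimage_emb hme, ← preimage_comp, hinv.comp_eq_id, preimage_id]

end LyapunovDomination

/-! ### The equivalence -/

theorem mainTheorem2 {n : ℕ} {H : Type*} [TopologicalSpace H]
    (I : ModelWithCorners ℝ (EuclideanSpace ℝ (Fin n)) H)
    {M : Type*} [TopologicalSpace M] [ChartedSpace H M] [IsManifold I ∞ M]
    [T2Space M] [CompactSpace M] [MeasurableSpace M] [BorelSpace M]
    [RiemannianBundle (fun x : M => TangentSpace I x)]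
    [IsContMDiffRiemannianBundle I ∞ (EuclideanSpace ℝ (Fin n))
      (fun x : M => TangentSpace I x)]
    (X : ∀ x : M, TangentSpace I x)
    (hX : LyapunovDomination.IsInwardAtBoundary X)
    (φ : ℝ → M → M) (hφ : LyapunovDomination.IsC1Flow X φ)
    (Λ : Set M) (hΛc : IsCompact Λ) (hΛ : LyapunovDomination.IsInvariantSet φ Λ)
    (E F : ∀ x : M, Submodule ℝ (TangentSpace I x))
    (hEF : LyapunovDomination.IsContinuousInvariantSplitting φ Λ E F) :
    LyapunovDomination.IsDominatedSplitting φ Λ E F ↔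
      ∃ η : ℝ, η < 0 ∧ ∃ Y : Set M, LyapunovDomination.HasTotalProbability φ Λ Y ∧
        ∀ x ∈ Y,
          liminf (fun t : ℝ =>
              (1 / t) * Real.log (LyapunovDomination.normRestrict φ t x (E x))) atTop -
            limsup (fun t : ℝ =>
              (1 / t) * Real.log (LyapunovDomination.conormRestrict φ t x (F x))) atTop < η := by
  open LyapunovDomination in
  have hΛK : CompactSpace Λ := isCompact_iff_compactSpace.1 hΛc
  have hposE : ∀ x ∈ Λ, ∀ t, 0 < normRestrict φ t x (E x) := fun x hx t =>
    normRestrict_pos hEF.invariant_left hΛ hEF.ne_bot_left hx t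
  have hposF : ∀ x ∈ Λ, ∀ t, 0 < conormRestrict φ t x (F x) := fun x hx t =>
    hEF.conormRestrict_pos hΛ hx t (hEF.ne_bot_right x hx)
  have hf := isSubadditiveCocycle_log_normRestrict hφ hΛc hΛ hEF.continuous_left
    hEF.invariant_left hEF.ne_bot_left
    fun x hx t => hEF.conormRestrict_pos hΛ hx t (hEF.ne_bot_left x hx)
  have hg := isSubadditiveCocycle_neg_log_conormRestrict hφ hΛc hΛ hEF.continuous_right
    hEF.invariant_right hEF.ne_bot_right hposF
  have hneg : ∀ x ∈ Λ, ∀ t, 0 ≤ t →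
      normRestrict φ t x (E x) * normRestrict φ (-t) (φ t x) (F (φ t x)) =
        Real.exp (Real.log (normRestrict φ t x (E x)) +
          -Real.log (conormRestrict φ t x (F x))) := fun x hx t ht => by
    rw [hφ.normRestrict_neg hEF.invariant_right hΛ hEF.ne_bot_right hx ht (hposF x hx t),
      Real.exp_add, Real.exp_log (hposE x hx t), Real.exp_neg, Real.exp_log (hposF x hx t)]
  simp only [limsup_eq_neg_liminf_neg, sub_neg_eq_add, ← mul_neg]
  constructor
  · rintro ⟨-, K, hK, r, hr, hdom⟩
    -- Domination bounds the sum of the rates by `-r` at every point of `Λ`; `-r / 2` makes the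
    -- inequality strict.
    refine ⟨-r / 2, by linarith, Λ, ⟨subset_rfl, hΛc.isClosed.measurableSet, fun μ hμ => ?_⟩,
      fun x hx => ?_⟩
    · have := hμ.isProbabilityMeasure
      exact (prob_compl_eq_zero_iff hΛc.isClosed.measurableSet).1 hμ.carried
    · obtain ⟨D, hD⟩ := hf.exists_eventually_abs_le
      obtain ⟨D', hD'⟩ := hg.exists_eventually_abs_le
      refine (liminf_add_liminf_le (a := max D D') (c := -r)
        ((hD ⟨x, hx⟩).mono fun t ht => ht.trans (le_max_left _ _))
        ((hD' ⟨x, hx⟩).mono fun t ht => ht.trans (le_max_right _ _))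
        fun ε hε => ?_).trans_lt (by linarith)
      filter_upwards [eventually_gt_atTop 0, eventually_ge_atTop (Real.log K / ε)] with t ht ht'
      have h1 := hdom x hx t ht
      rw [hneg x hx t ht.le, ← Real.exp_log hK, ← Real.exp_add, Real.exp_lt_exp] at h1
      rw [div_le_iff₀ hε] at ht'
      rw [← mul_add, one_div_mul_eq_div, div_le_iff₀ ht]
      linarith
  · rintro ⟨η, hη, Y, ⟨hYΛ, hYm, hY⟩, hYη⟩
    have : SecondCountableTopology H := I.secondCountableTopology
    have : SecondCountableTopology M := ChartedSpace.secondCountable_of_sigmaCompact H M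
    obtain ⟨K, r, hr, hdecay⟩ := hf.exists_linear_decay_of_ae (hφ.isSemiflow_restrict hΛ) hg hη
      fun μ hμ hinv => by
        have hν := isInvariantProbability_map_val hφ hΛc hΛ hinv
        have := hν.isProbabilityMeasure
        have hae : ∀ᵐ x ∂(μ.map (Subtype.val : Λ → M)), x ∈ Y :=
          mem_ae_iff_prob_eq_one hYm |>.2 (hY _ hν)
        filter_upwards [ae_of_ae_map measurable_subtype_coe.aemeasurable hae] with x hx
        exact (add_le_add (hf.liminf_nat_le_liminf_real x) (hg.liminf_nat_le_liminf_real x)).trans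
          (hYη x hx).le
    -- The added `1` turns the bound `exp K * exp (-r t)` into a strict one.
    refine ⟨hEF, Real.exp K + 1, by positivity, r, hr, fun x hx t ht => ?_⟩
    rw [hneg x hx t ht.le]
    have h1 : Real.log (normRestrict φ t x (E x)) + -Real.log (conormRestrict φ t x (F x)) ≤
        K - r * t := hdecay t ht.le ⟨x, hx⟩
    have h2 := Real.exp_le_exp.2 h1
    rw [sub_eq_add_neg, Real.exp_add K, ← neg_mul] at h2
    refine h2.trans_lt ?_
    gcongr
    linarith
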